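/- For a finite poset $P$ and $k\ge 0$ let $c_k(P)$ be the maximal cardinality of a union of $k$ chains of $P$; the shape $\lambda(P)$ is the Young diagram whose $k$-th row has length $c_k(P)-c_{k-1}(P)$, $k\ge 1$. Let $n\ge 0$. For a permutation $\sigma$ of $[n]=\{1,\dots,n\}$ let $P_\sigma=\{(k,\sigma(k)):k\in[n]\}$, ordered by $(k,\sigma(k))\le(l,\sigma(l))$ iff $k\le l$ and $\sigma(k)\le\sigma(l)$, let $P_\sigma[i;j]=\{(k,\sigma(k)): i\le k\le j\}$, and let $\lambda_{[i;j]}=\lambda(P_\sigma[i;j])$. Then: (0) The shapes $\lambda_{[i;j]}$ are well defined, i.e. the numbers $c_k-c_{k-1}$ of $P_\sigma[i;j]$ are the row lengths of a Young diagram. (1) Let $1<i\le j<n$. The shape $\lambda_{[i;j+1]}$ is uniquely determined by $\lambda_{[i-1;j]}$, $\lambda_{[i;j]}$ and $\lambda_{[i-1;j+1]}$, as follows. If there is a shape $\lambda\ne\lambda_{[i-1;j]}$ with $\lambda_{[i;j]}\subsetneq\lambda\subsetneq\lambda_{[i-1;j+1]}$, then $\lambda$ is unique and $\lambda_{[i;j+1]}=\lambda$.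 Otherwise $\lambda_{[i;j+1]}=\lambda_{[i-1;j]}$. (2) There are unique standard Young tableaux $Q(\sigma)$ and $Q'(\sigma)$ with $n$ boxes such that, for $0\le k\le n$, the entries $1,\dots,k$ of $Q(\sigma)$ form the shape $\lambda_{[1;k]}$ and the entries $1,\dots,k$ of $Q'(\sigma)$ form the shape $\lambda_{[n+1-k;n]}$ (empty for $k=0$). Moreover $Q'(\sigma)=Q(\sigma')$, where $\sigma'(i)=n+1-\sigma(n+1-i)$. (3) For a standard Young tableau $T$ with $n$ boxes, let $\Lambda_{[1;j]}$ be the shape formed by the entries $1,\dots,j$ of $T$, let $\Lambda_{[i;i]}$ be a single box, and compute $\Lambda_{[i;j]}$, $1\le i\le j\le n$, recursively by the rule in (1). There is a unique standard Young tableau $\mathrm{ev}(T)$ with $n$ boxes whose entries $1,\dots,k$ form the shape $\Lambda_{[n+1-k;n]}$ for $1\le k\le n$. If $T=Q(\sigma)$, then $\Lambda_{[i;j]}=\lambda_{[i;j]}$ for all $1\le i\le j\le n$, and $\mathrm{ev}(Q(\sigma))=Q'(\sigma)$; in particular $Q'(\sigma)$ depends only on $Q(\sigma)$. The map $T\mapsto\mathrm{ev}(T)$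 (the Schützenberger involution) is a shape-preserving involution on the set of standard Young tableaux with $n$ boxes. -/

import Mathlib

namespace PosetGrowth

/-- For a finite subset `S` of a partially ordered set (a finite poset with the induced order),
`maxChainUnion S k` is the maximal cardinality `c_k` of a union of `k` chains of `S`.
A chain is a totally ordered subset, possibly empty. -/
noncomputable def maxChainUnion {α : Type*} [PartialOrder α] [DecidableEq α]
    (S : Finset α) (k : ℕ) : ℕ :=
  sSup {m : ℕ | ∃ C : Fin k → Finset α,
    (∀ t, C t ⊆ S ∧ IsChain (· ≤ ·) (C t : Set α)) ∧
      m = (Finset.univ.biUnion C).card}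

/-- The number `c_{r+1} - c_r`, the length of row number `r` (counted from `0`) of the shape. -/
noncomputable def chainRow {α : Type*} [PartialOrder α] [DecidableEq α]
    (S : Finset α) (r : ℕ) : ℕ :=
  maxChainUnion S (r + 1) - maxChainUnion S r

open Classical in
/-- The shape of a finite poset `S`: the Young diagram with row lengths
`c_1 - c_0, c_2 - c_1, …`. The clause over all `r ≤ c.1` makes the set of cells a lower set by
construction; it is redundant as soon as `chainRow S` is weakly decreasing. -/
noncomputable def shape {α : Type*} [PartialOrder α] [DecidableEq α]
    (S : Finset α) : YoungDiagram where
  cells := (Finset.range S.card ×ˢ Finset.range S.card).filter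
    fun c => ∀ r ≤ c.1, c.2 < chainRow S r
  isLowerSet := by
    rintro ⟨a, b⟩ ⟨a', b'⟩ h hc
    obtain ⟨h1, h2⟩ := Prod.mk_le_mk.mp h
    simp only [Finset.coe_filter, Finset.mem_product, Finset.mem_range, Set.mem_ofPred_eq] at hc ⊢
    exact ⟨⟨by omega, by omega⟩, fun r hr => lt_of_le_of_lt h2 (hc.2 r (hr.trans h1))⟩

/-- The subposet `P_σ[i;j] = {(k, σ(k)) : i ≤ k ≤ j}` of the permutation poset `P_σ`, which
carries the order induced from the product of two chains with `n` elements. Positions are counted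
from `1`: the element `k : Fin n` is position `k + 1`. -/
def permInterval {n : ℕ} (σ : Equiv.Perm (Fin n)) (i j : ℕ) : Finset (Fin n × Fin n) :=
  (Finset.univ.filter fun k : Fin n => i ≤ (k : ℕ) + 1 ∧ (k : ℕ) + 1 ≤ j).image
    fun k => (k, σ k)

/-- The shape `λ_[i;j]` of `P_σ[i;j]`. -/
noncomputable def intervalShape {n : ℕ} (σ : Equiv.Perm (Fin n)) (i j : ℕ) : YoungDiagram :=
  shape (permInterval σ i j)

/-- The permutation `σ'` with `σ'(i) = n + 1 - σ(n + 1 - i)`. -/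
def rotate {n : ℕ} (σ : Equiv.Perm (Fin n)) : Equiv.Perm (Fin n) :=
  Fin.revPerm * σ * Fin.revPerm

/-- Standard Young tableaux with `n` boxes: fillings of a Young diagram by `1, …, n`, each used
exactly once, increasing along rows and down columns. Outside the diagram `entry` is `0`. -/
@[ext]
structure StandardTableau (n : ℕ) where
  diagram : YoungDiagram
  entry : ℕ × ℕ → ℕ
  bijOn : Set.BijOn entry (diagram.cells : Set (ℕ × ℕ)) (Set.Icc 1 n)
  row_lt : ∀ {r s t : ℕ}, s < t → (r, t) ∈ diagram → entry (r, s) < entry (r, t)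
  col_lt : ∀ {q r s : ℕ}, q < r → (r, s) ∈ diagram → entry (q, s) < entry (r, s)
  zeros : ∀ c : ℕ × ℕ, c ∉ diagram → entry c = 0

namespace StandardTableau

theorem entry_le {n : ℕ} (T : StandardTableau n) {c d : ℕ × ℕ} (h : d ≤ c)
    (hc : c ∈ T.diagram) : T.entry d ≤ T.entry c := by
  obtain ⟨a, b⟩ := c
  obtain ⟨a', b'⟩ := d
  obtain ⟨h1, h2⟩ := Prod.mk_le_mk.mp h
  have hm : (a, b') ∈ T.diagram := T.diagram.up_left_mem le_rfl h2 hc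
  have e1 : T.entry (a', b') ≤ T.entry (a, b') := by
    rcases h1.eq_or_lt with rfl | h1
    · exact le_rfl
    · exact (T.col_lt h1 hm).le
  have e2 : T.entry (a, b') ≤ T.entry (a, b) := by
    rcases h2.eq_or_lt with rfl | h2
    · exact le_rfl
    · exact (T.row_lt h2 hc).le
  exact e1.trans e2

/-- The Young diagram formed by the boxes of `T` with entries `1, …, k`. -/
def sub {n : ℕ} (T : StandardTableau n) (k : ℕ) : YoungDiagram where
  cells := T.diagram.cells.filter fun c => T.entry c ≤ k
  isLowerSet := by
    intro c d h hc
    simp only [Finset.coe_filter, Set.mem_ofPred_eq] at hc ⊢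
    exact ⟨T.diagram.isLowerSet h hc.1, (T.entry_le h hc.1).trans hc.2⟩

/-- `T` encodes the sequence of shapes `μ 0, …, μ n`: for every `k ≤ n`, the entries `1, …, k`
of `T` form the shape `μ k`. -/
def Encodes {n : ℕ} (T : StandardTableau n) (μ : ℕ → YoungDiagram) : Prop :=
  ∀ k ≤ n, T.sub k = μ k

/-- A sequence of shapes is encoded by at most one standard tableau. -/
theorem Encodes.unique {n : ℕ} {T U : StandardTableau n} {μ : ℕ → YoungDiagram}
    (hT : T.Encodes μ) (hU : U.Encodes μ) : T = U := by
  have mem : ∀ (V : StandardTableau n) (k : ℕ) (c : ℕ × ℕ),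
      c ∈ (V.sub k).cells ↔ c ∈ V.diagram.cells ∧ V.entry c ≤ k := by
    intro V k c
    simp [sub]
  have full : ∀ V : StandardTableau n, (V.sub n).cells = V.diagram.cells := by
    intro V
    ext c
    rw [mem]
    exact ⟨fun h => h.1, fun h => ⟨h, (V.bijOn.mapsTo h).2⟩⟩
  have eqs : ∀ k ≤ n, T.sub k = U.sub k := fun k hk => (hT k hk).trans (hU k hk).symm
  have hd : T.diagram = U.diagram := by
    apply YoungDiagram.ext
    rw [← full T, ← full U, eqs n le_rfl]
  have one : ∀ V W : StandardTableau n, (∀ k ≤ n, V.sub k = W.sub k) →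
      ∀ c ∈ V.diagram.cells, W.entry c ≤ V.entry c := by
    intro V W h c hc
    have h1 : c ∈ (V.sub (V.entry c)).cells := (mem V _ c).2 ⟨hc, le_rfl⟩
    rw [h _ (V.bijOn.mapsTo hc).2] at h1
    exact ((mem W _ c).1 h1).2
  refine StandardTableau.ext hd (funext fun c => ?_)
  by_cases hc : c ∈ T.diagram.cells
  · exact le_antisymm (one U T (fun k hk => (eqs k hk).symm) c (hd ▸ hc)) (one T U eqs c hc)
  · rw [T.zeros c hc, U.zeros c (hd ▸ hc)]

end StandardTableau

/-- The Young diagram with a single box. -/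
def oneBox : YoungDiagram where
  cells := {(0, 0)}
  isLowerSet := by
    intro c d h hc
    simp only [Finset.coe_singleton, Set.mem_singleton_iff] at hc ⊢
    subst hc
    exact le_antisymm h ⟨Nat.zero_le _, Nat.zero_le _⟩

open Classical in
/-- The local growth rule: a shape `ν ≠ left` with `bottom ⊊ ν ⊊ top` if there is one, and
`left` otherwise. -/
noncomputable def localRule (left bottom top : YoungDiagram) : YoungDiagram :=
  if h : ∃ ν : YoungDiagram, ν ≠ left ∧ bottom < ν ∧ ν < top then h.choose else left

/-- Row `i` of a triangular array of shapes `λ_[i;j]`, `i ≤ j`, computed from row `i - 1`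
(`prev`): it starts with `λ_[i;i]`, a single box, and continues by the local rule. -/
noncomputable def nextRow (i : ℕ) (prev : ℕ → YoungDiagram) : ℕ → YoungDiagram
  | 0 => ⊥
  | j + 1 =>
    if j + 1 < i then ⊥
    else if j + 1 = i then oneBox
    else localRule (prev j) (nextRow i prev j) (prev (j + 1))

/-- The triangular array with first row `μ 1, μ 2, …`, computed by the local rule. The value at
`(i, j)` is the shape in position `[i;j]`, for `1 ≤ i ≤ j`; it is empty for `i = j + 1 ≥ 2`. -/
noncomputable def growthArray (μ : ℕ → YoungDiagram) : ℕ → ℕ → YoungDiagram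
  | 0 => fun _ => ⊥
  | 1 => μ
  | i + 2 => nextRow (i + 2) (growthArray μ (i + 1))

end PosetGrowth

/-!
The row lengths of Greene's theorem, for words and for their reversals, are unchanged by Knuth moves
and can be read off the tableau to which every word is Knuth equivalent. Hence appending a letter
adds one box to the shape of a word, and so does prepending one, since reversal transposes shapes.

Let prepending `p` to `w` add the box `a`, and appending `q` add the box `b`. If `a ≠ b`, the shapes
of `p w` and `w q` are the two shapes strictly between those of `w` and `p w q`; Young's lattice is
distributive, so there is no third. If `a = b`, then `p w q` adds a further box in the row or in
the column of `a`, and no second shape fits in between; this is proved by induction on the length of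
`w`, removing the largest letter.

The local rule exchanges the two shapes in between, if there are two. It is thus its own inverse and
computes the triangular array from the last column as well as from the first row. So reflecting the
array of `T` gives that of `ev(T)`, and `ev` is an involution; as reversing and complementing a word
preserves its shape, `ev(Q(σ)) = Q(σ')`.
-/

namespace PosetGrowth

section YoungDiagrams

/-- `ν` arises from `μ` by adding the cell `c`. -/
def AddBox (μ : YoungDiagram) (c : ℕ × ℕ) (ν : YoungDiagram) : Prop :=
  c ∉ μ ∧ ν.cells = insert c μ.cells

namespace AddBox

variable {μ ν ν' κ ξ : YoungDiagram} {a b a' b' : ℕ × ℕ}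

theorem notMem (h : AddBox μ a ν) : a ∉ μ := h.1

theorem mem_iff (h : AddBox μ a ν) {d : ℕ × ℕ} : d ∈ ν ↔ d = a ∨ d ∈ μ := by
  rw [← YoungDiagram.mem_cells, h.2, Finset.mem_insert, YoungDiagram.mem_cells]

theorem mem (h : AddBox μ a ν) : a ∈ ν := h.mem_iff.2 (Or.inl rfl)

theorem le (h : AddBox μ a ν) : μ ≤ ν := fun _ hd => h.mem_iff.2 (Or.inr hd)

theorem lt (h : AddBox μ a ν) : μ < ν :=
  lt_of_le_of_ne h.le fun e => h.notMem (e ▸ h.mem)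

theorem card (h : AddBox μ a ν) : ν.card = μ.card + 1 := by
  rw [YoungDiagram.card, h.2, Finset.card_insert_of_notMem (by simpa using h.notMem)]

theorem cell_unique (h : AddBox μ a ν) (h' : AddBox μ b ν) : a = b :=
  (h'.mem_iff.1 h.mem).resolve_right h.notMem

theorem right_unique (h : AddBox μ a ν) (h' : AddBox μ a κ) : ν = κ :=
  YoungDiagram.ext (h.2.trans h'.2.symm)

theorem transpose (h : AddBox μ a ν) : AddBox μ.transpose a.swap ν.transpose := by
  refine ⟨by simpa using h.notMem, ?_⟩
  ext d
  simp [h.mem_iff, Prod.ext_iff, and_comm]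

theorem of_rowLen {r : ℕ} (h : ∀ i, ν.rowLen i = μ.rowLen i + if i = r then 1 else 0) :
    AddBox μ (r, μ.rowLen r) ν := by
  refine ⟨by simp [YoungDiagram.mem_iff_lt_rowLen], ?_⟩
  ext ⟨i, j⟩
  simp only [Finset.mem_insert, YoungDiagram.mem_cells, YoungDiagram.mem_iff_lt_rowLen, h,
    Prod.mk.injEq]
  grind

theorem covBy (h : AddBox μ a ν) : μ ⋖ ν := by
  refine ⟨h.lt, fun κ h₁ h₂ => ?_⟩
  have := Finset.card_lt_card (YoungDiagram.cells_ssubset_iff.2 h₁)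
  have := Finset.card_lt_card (YoungDiagram.cells_ssubset_iff.2 h₂)
  have := h.card
  unfold YoungDiagram.card at this
  omega

theorem exists_of_covBy (h : μ ⋖ ν) : ∃ c, AddBox μ c ν := by
  obtain ⟨c, hc⟩ := (ν.cells \ μ.cells).exists_minimal
    (Finset.sdiff_nonempty.2 fun hs => h.lt.not_ge (YoungDiagram.cells_subset_iff.1 hs))
  have hcν : c ∈ ν.cells := (Finset.mem_sdiff.1 hc.prop).1
  have hcμ : c ∉ μ.cells := (Finset.mem_sdiff.1 hc.prop).2
  let κ : YoungDiagram :=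
    { cells := insert c μ.cells
      isLowerSet := fun a b hba ha => by
        rw [Finset.mem_coe, Finset.mem_insert] at ha ⊢
        rcases ha with rfl | ha
        · by_contra! hb
          have hbν := ν.isLowerSet hba hcν
          exact hb.1 (le_antisymm hba (hc.le_of_le (Finset.mem_sdiff.2 ⟨hbν, hb.2⟩) hba))
        · exact Or.inr (μ.isLowerSet hba ha) }
  have hκ : AddBox μ c κ := ⟨hcμ, rfl⟩
  have hle : κ ≤ ν := YoungDiagram.cells_subset_iff.1
    (Finset.insert_subset hcν (YoungDiagram.cells_subset_iff.2 h.le))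
  exact ⟨c, (h.eq_or_eq hκ.le hle).resolve_left hκ.lt.ne' ▸ hκ⟩

theorem eq_or_eq_of_mem (h : AddBox μ a ν) (h₁ : AddBox ν b κ) (h' : AddBox μ a' ν')
    (h₁' : AddBox ν' b' κ) : (a = a' ∧ b = b') ∨ (a = b' ∧ b = a') := by
  have key : ∀ d, (d = b ∨ d = a ∨ d ∈ μ) ↔ (d = b' ∨ d = a' ∨ d ∈ μ) := fun d => by
    rw [← h.mem_iff, ← h₁.mem_iff, h₁'.mem_iff, h'.mem_iff]
  have hb := h₁.notMem
  have hb' := h₁'.notMem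
  rw [h.mem_iff] at hb
  rw [h'.mem_iff] at hb'
  have := h.notMem
  have := h'.notMem
  have := key a
  have := key b
  have := key a'
  have := key b'
  grind

theorem not_diagonal (h : AddBox μ a ν) (h₁ : AddBox ν b κ) :
    ¬ (b.1 = a.1 + 1 ∧ b.2 = a.2 + 1) := by
  rintro ⟨e₁, e₂⟩
  have hmem : (a.1 + 1, a.2) ∈ κ := κ.up_left_mem (by omega) (by omega) (h₁.mem : (b.1, b.2) ∈ κ)
  rw [h₁.mem_iff, h.mem_iff] at hmem
  rcases hmem with h₂ | h₂ | h₂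
  · simp [← h₂] at e₂
  · simpa using congrArg Prod.fst h₂
  · exact h.notMem (μ.up_left_mem (i1 := a.1) (j1 := a.2) (by omega) le_rfl h₂)

-- Of two cells in the same row or column, only one order of adding them gives diagrams.
theorem eq_of_aligned (h : AddBox μ a ν) (h₁ : AddBox ν b κ) (hab : b.1 = a.1 ∨ b.2 = a.2)
    (h₂ : μ ⋖ ξ) (h₃ : ξ ≤ κ) : ξ = ν := by
  obtain ⟨d, hd⟩ := exists_of_covBy h₂
  have hdκ := h₃ hd.mem
  change d ∈ κ at hdκ
  rw [h₁.mem_iff, h.mem_iff] at hdκ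
  rcases hdκ with rfl | rfl | hdμ
  · have not_le : ¬ (d.1 ≤ a.1 ∧ d.2 ≤ a.2) := fun hle =>
      h₁.notMem (ν.up_left_mem hle.1 hle.2 h.mem)
    have not_ge : ¬ (a.1 ≤ d.1 ∧ a.2 ≤ d.2) := fun hle => by
      rcases hd.mem_iff.1 (ξ.up_left_mem hle.1 hle.2 hd.mem) with rfl | ha
      · exact h₁.notMem h.mem
      · exact h.notMem ha
    omega
  · exact hd.right_unique h
  · exact absurd hdμ hd.notMem

end AddBox

theorem eq_of_rowLen_eq {μ ν : YoungDiagram} (h : ∀ i, μ.rowLen i = ν.rowLen i) : μ = ν := by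
  ext ⟨i, j⟩
  rw [YoungDiagram.mem_cells, YoungDiagram.mem_cells, YoungDiagram.mem_iff_lt_rowLen,
    YoungDiagram.mem_iff_lt_rowLen, h]

theorem addBox_bot_oneBox : AddBox ⊥ (0, 0) oneBox :=
  ⟨YoungDiagram.notMem_bot _, by simp [oneBox]⟩

theorem eq_oneBox_of_bot_covBy {ν : YoungDiagram} (h : ⊥ ⋖ ν) : ν = oneBox := by
  obtain ⟨c, hc⟩ := AddBox.exists_of_covBy h
  have hmem : (0, 0) ∈ ν := ν.up_left_mem (Nat.zero_le _) (Nat.zero_le _) (hc.mem : (c.1, c.2) ∈ ν)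
  obtain rfl := (hc.mem_iff.1 hmem).resolve_right (YoungDiagram.notMem_bot _)
  exact hc.right_unique addBox_bot_oneBox

end YoungDiagrams

section LocalRule

theorem inf_eq_and_sup_eq_of_covBy {L : Type*} [Lattice L] {a b c x : L}
    (hab : a ⋖ b) (hbc : b ⋖ c) (hax : a < x) (hxc : x < c) (hne : x ≠ b) :
    x ⊓ b = a ∧ x ⊔ b = c := by
  refine ⟨(hab.eq_or_eq (le_inf hax.le hab.le) inf_le_right).resolve_right fun h => ?_,
    (hbc.eq_or_eq le_sup_right (sup_le hxc.le hbc.le)).resolve_left fun h => ?_⟩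
  · exact hbc.2 (lt_of_le_of_ne (inf_eq_right.1 h) hne.symm) hxc
  · exact hab.2 hax (lt_of_le_of_ne (sup_eq_right.1 h) hne)

variable {left bottom top ν : YoungDiagram}

theorem covBy_of_between (hb : bottom ⋖ left) (ht : left ⋖ top) (hbν : bottom < ν) (hνt : ν < top)
    (hne : ν ≠ left) : bottom ⋖ ν ∧ ν ⋖ top := by
  obtain ⟨hinf, hsup⟩ := inf_eq_and_sup_eq_of_covBy hb ht hbν hνt hne
  constructor
  · rw [← hinf, inf_comm]
    apply CovBy.inf_of_sup_left
    rwa [sup_comm, hsup]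
  · rw [← hsup, sup_comm]
    apply CovBy.sup_of_inf_left
    rwa [inf_comm, hinf]

/-- Two complements of `left` in the interval agree because the lattice of Young diagrams is
distributive. -/
theorem localRule_eq_of_between (hb : bottom ⋖ left) (ht : left ⋖ top) (hbν : bottom < ν)
    (hνt : ν < top) (hne : ν ≠ left) : localRule left bottom top = ν := by
  have h : ∃ ν : YoungDiagram, ν ≠ left ∧ bottom < ν ∧ ν < top := ⟨ν, hne, hbν, hνt⟩
  obtain ⟨hne', hb', ht'⟩ := h.choose_spec
  obtain ⟨hinf, hsup⟩ := inf_eq_and_sup_eq_of_covBy hb ht hbν hνt hne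
  obtain ⟨hinf', hsup'⟩ := inf_eq_and_sup_eq_of_covBy hb ht hb' ht' hne'
  rw [localRule, dif_pos h]
  exact eq_of_inf_eq_sup_eq (hinf'.trans hinf.symm) (hsup'.trans hsup.symm)

theorem localRule_eq_left (h : ∀ ν, bottom < ν → ν < top → ν = left) :
    localRule left bottom top = left :=
  dif_neg fun ⟨ν, hne, hb, ht⟩ => hne (h ν hb ht)

theorem localRule_covBy (hb : bottom ⋖ left) (ht : left ⋖ top) :
    bottom ⋖ localRule left bottom top ∧ localRule left bottom top ⋖ top := by
  by_cases h : ∃ ν, ν ≠ left ∧ bottom < ν ∧ ν < top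
  · obtain ⟨ν, hne, hbν, hνt⟩ := h
    rw [localRule_eq_of_between hb ht hbν hνt hne]
    exact covBy_of_between hb ht hbν hνt hne
  · rw [localRule, dif_neg h]
    exact ⟨hb, ht⟩

theorem localRule_localRule (hb : bottom ⋖ left) (ht : left ⋖ top) :
    localRule (localRule left bottom top) bottom top = left := by
  by_cases h : ∃ ν, ν ≠ left ∧ bottom < ν ∧ ν < top
  · obtain ⟨ν, hne, hbν, hνt⟩ := h
    obtain ⟨hbν', hνt'⟩ := covBy_of_between hb ht hbν hνt hne
    rw [localRule_eq_of_between hb ht hbν hνt hne]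
    exact localRule_eq_of_between hbν' hνt' hb.lt ht.lt hne.symm
  · have hleft : localRule left bottom top = left := dif_neg h
    rw [hleft, hleft]

end LocalRule

section LocalGrowth

/-- A sequence of shapes `∅ = μ 0, μ 1, …, μ n`, each with one box more than the preceding one. -/
def IsGrowth (n : ℕ) (μ : ℕ → YoungDiagram) : Prop :=
  μ 0 = ⊥ ∧ ∀ k < n, μ k ⋖ μ (k + 1)

/-- A triangular array of shapes, growing along its first row, whose other rows follow the local
rule. The shape `D i j`, `i ≤ j ≤ n`, belongs to the half-open interval `[i, j)` of positions, that
is, to `[i+1; j]` in the notation with closed intervals counted from `1`. -/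
structure IsLocalGrowth (n : ℕ) (D : ℕ → ℕ → YoungDiagram) : Prop where
  diag : ∀ i ≤ n, D i i = ⊥
  row : ∀ j < n, D 0 j ⋖ D 0 (j + 1)
  rule : ∀ {i j}, i < j → j < n → D (i + 1) (j + 1) = localRule (D i j) (D (i + 1) j) (D i (j + 1))

variable {n : ℕ}

theorem covBy_of_localRule {f g : ℕ → YoungDiagram} {i : ℕ}
    (hf : ∀ j, i ≤ j → j < n → f j ⋖ f (j + 1)) (hfi : f i = ⊥) (hgi : g (i + 1) = ⊥)
    (hg : ∀ j, i < j → j < n → g (j + 1) = localRule (f j) (g j) (f (j + 1))) {j : ℕ}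
    (hij : i < j) (hjn : j ≤ n) : g j ⋖ f j := by
  induction j, hij using Nat.le_induction with
  | base => rw [hgi, ← hfi]; exact hf i le_rfl hjn
  | succ j hij ih =>
    rw [hg j hij hjn]
    exact (localRule_covBy (ih (by omega)) (hf j (by omega) hjn)).2

namespace IsLocalGrowth

variable {D D' : ℕ → ℕ → YoungDiagram} {i j : ℕ}

theorem covBy_row (h : IsLocalGrowth n D) (hij : i ≤ j) (hjn : j < n) : D i j ⋖ D i (j + 1) := by
  induction i generalizing j with
  | zero => exact h.row j hjn
  | succ i ih =>
    have hcol := covBy_of_localRule (fun j => ih (j := j)) (h.diag i (by omega))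
      (h.diag (i + 1) (by omega)) (fun j => h.rule) hij hjn.le
    rw [h.rule hij hjn]
    exact (localRule_covBy hcol (ih (by omega) hjn)).1

theorem isGrowth_row (h : IsLocalGrowth n D) : IsGrowth n (D 0) :=
  ⟨h.diag 0 n.zero_le, h.row⟩

theorem covBy_col (h : IsLocalGrowth n D) (hij : i < j) (hjn : j ≤ n) : D (i + 1) j ⋖ D i j :=
  covBy_of_localRule (fun _ => h.covBy_row) (h.diag i (by omega)) (h.diag (i + 1) (by omega))
    (fun _ => h.rule) hij hjn

theorem ext (h : IsLocalGrowth n D) (h' : IsLocalGrowth n D') (hrow : ∀ j ≤ n, D 0 j = D' 0 j)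
    (hij : i ≤ j) (hjn : j ≤ n) : D i j = D' i j := by
  induction i generalizing j with
  | zero => exact hrow j hjn
  | succ i ih =>
    induction j, hij using Nat.le_induction with
    | base => rw [h.diag _ hjn, h'.diag _ hjn]
    | succ j hij ihj =>
      rw [h.rule hij hjn, h'.rule hij hjn, ih (by omega) (by omega), ihj (by omega),
        ih (by omega) hjn]

/-- The local rule is an involution in its first argument, so it also computes the array from its
last column. -/
theorem reflect (h : IsLocalGrowth n D) : IsLocalGrowth n fun i j => D (n - j) (n - i) where
  diag i _ := h.diag (n - i) (by omega)
  row j hj := by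
    have := h.covBy_col (i := n - (j + 1)) (j := n) (by omega) le_rfl
    rwa [show n - (j + 1) + 1 = n - j by omega] at this
  rule {i j} hij hjn := by
    obtain ⟨a, ha⟩ : ∃ a, n - j = a + 1 := ⟨n - (j + 1), by omega⟩
    obtain ⟨b, hb⟩ : ∃ b, n - i = b + 1 := ⟨n - (i + 1), by omega⟩
    have ha' : n - (j + 1) = a := by omega
    have hb' : n - (i + 1) = b := by omega
    simp only [ha, hb, ha', hb']
    rw [h.rule (by omega) (by omega), localRule_localRule
      (h.covBy_col (by omega) (by omega)) (h.covBy_row (by omega) (by omega))]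

end IsLocalGrowth

theorem growthArray_diag {μ : ℕ → YoungDiagram} (hμ : μ 0 = ⊥) (i : ℕ) :
    growthArray μ (i + 1) i = ⊥ := by
  cases i with
  | zero => exact hμ
  | succ i => simp [growthArray, nextRow]

theorem growthArray_rule {μ : ℕ → YoungDiagram} (hμ : μ 0 = ⊥) {i j : ℕ}
    (hrow : ∀ j, i ≤ j → j < n → growthArray μ (i + 1) j ⋖ growthArray μ (i + 1) (j + 1))
    (hij : i < j) (hjn : j < n) :
    growthArray μ (i + 2) (j + 1) = localRule (growthArray μ (i + 1) j) (growthArray μ (i + 2) j)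
      (growthArray μ (i + 1) (j + 1)) := by
  rcases (Nat.succ_le_of_lt hij).eq_or_lt with rfl | hij'
  · rw [growthArray_diag hμ (i + 1), eq_oneBox_of_bot_covBy (localRule_covBy ?_ ?_).1]
    · simp [growthArray, nextRow]
    · rw [← growthArray_diag hμ i]
      exact hrow i le_rfl (by omega)
    · exact hrow (i + 1) (by omega) hjn
  · simp only [growthArray]
    rw [nextRow, if_neg (by omega), if_neg (by omega)]

theorem isLocalGrowth_growthArray {μ : ℕ → YoungDiagram} (hμ : IsGrowth n μ) :
    IsLocalGrowth n fun i j => growthArray μ (i + 1) j := by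
  have hrow : ∀ i j, i ≤ j → j < n → growthArray μ (i + 1) j ⋖ growthArray μ (i + 1) (j + 1) := by
    intro i
    induction i with
    | zero => exact fun j _ hj => hμ.2 j hj
    | succ i ih =>
      intro j hij hjn
      have hrule := fun j => growthArray_rule (j := j) hμ.1 ih
      have hcol := covBy_of_localRule ih (growthArray_diag hμ.1 i) (growthArray_diag hμ.1 (i + 1))
        hrule hij hjn.le
      rw [hrule j hij hjn]
      exact (localRule_covBy hcol (ih j (by omega) hjn)).1
  exact ⟨fun i _ => growthArray_diag hμ.1 i, fun j hj => hrow 0 j (Nat.zero_le j) hj,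
    growthArray_rule hμ.1 (hrow _)⟩

end LocalGrowth

section Tableaux

variable {n : ℕ} {μ : ℕ → YoungDiagram}

theorem IsGrowth.mono (h : IsGrowth n μ) {k l : ℕ} (hkl : k ≤ l) (hl : l ≤ n) : μ k ≤ μ l := by
  induction l, hkl using Nat.le_induction with
  | base => exact le_rfl
  | succ l _ ih => exact (ih (by omega)).trans (h.2 l hl).le

/-- The time at which the cell `c` appears in the sequence of shapes `μ`; it is the junk value `0`
if `c` never appears. -/
noncomputable def birth (μ : ℕ → YoungDiagram) (c : ℕ × ℕ) : ℕ :=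
  sInf {k | c ∈ μ k}

namespace IsGrowth

variable {c d : ℕ × ℕ}

theorem birth_le_iff (h : IsGrowth n μ) (hc : c ∈ μ n) {k : ℕ} (hk : k ≤ n) :
    birth μ c ≤ k ↔ c ∈ μ k :=
  ⟨fun hle => h.mono hle hk (Nat.sInf_mem (s := {k | c ∈ μ k}) ⟨n, hc⟩), fun hck => Nat.sInf_le hck⟩

theorem birth_eq_succ_iff (h : IsGrowth n μ) (hc : c ∈ μ n) {k : ℕ} (hk : k < n) :
    birth μ c = k + 1 ↔ AddBox (μ k) c (μ (k + 1)) := by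
  have hle := h.birth_le_iff hc hk.le
  have hle' := h.birth_le_iff hc (Nat.succ_le_of_lt hk)
  obtain ⟨b, hb⟩ := AddBox.exists_of_covBy (h.2 k hk)
  constructor
  · intro e
    have hcb := (hb.mem_iff.1 (hle'.1 e.le)).resolve_right fun hck => by
      have := hle.2 hck
      omega
    rwa [hcb]
  · intro hck
    have := hle'.2 hck.mem
    have := mt hle.1 hck.notMem
    omega

theorem birth_mem_Icc (h : IsGrowth n μ) (hc : c ∈ μ n) : birth μ c ∈ Set.Icc 1 n := by
  refine ⟨Nat.one_le_iff_ne_zero.2 fun h0 => ?_, (h.birth_le_iff hc le_rfl).2 hc⟩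
  have := (h.birth_le_iff hc (Nat.zero_le n)).1 h0.le
  rw [h.1] at this
  exact YoungDiagram.notMem_bot _ this

theorem birth_bijOn (h : IsGrowth n μ) : Set.BijOn (birth μ) (μ n).cells (Set.Icc 1 n) := by
  refine ⟨fun c => h.birth_mem_Icc, fun c hc d hd hcd => ?_, ?_⟩
  · obtain ⟨h₁, hn⟩ := h.birth_mem_Icc hc
    obtain ⟨k, hk⟩ := Nat.exists_eq_add_of_le' h₁
    rw [hk] at hn
    exact ((h.birth_eq_succ_iff hc hn).1 hk).cell_unique
      ((h.birth_eq_succ_iff hd hn).1 (hcd ▸ hk))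
  · rintro k ⟨h₁, hn⟩
    obtain ⟨k, rfl⟩ := Nat.exists_eq_add_of_le' h₁
    obtain ⟨b, hb⟩ := AddBox.exists_of_covBy (h.2 k hn)
    have hbn : b ∈ μ n := h.mono hn le_rfl hb.mem
    exact ⟨b, hbn, (h.birth_eq_succ_iff hbn hn).2 hb⟩

theorem birth_strictMono (h : IsGrowth n μ) (hc : c ∈ μ n) (hdc : d < c) :
    birth μ d < birth μ c := by
  have hd : d ∈ μ n := (μ n).isLowerSet hdc.le hc
  have hcn := (h.birth_mem_Icc hc).2
  refine lt_of_le_of_ne ((h.birth_le_iff hd hcn).2 ?_) fun e => hdc.ne (h.birth_bijOn.injOn hd hc e)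
  exact (μ _).isLowerSet hdc.le ((h.birth_le_iff hc hcn).1 le_rfl)

open Classical in
/-- The standard tableau whose entries record the order in which the boxes of `μ n` appear. -/
noncomputable def tableau (h : IsGrowth n μ) : StandardTableau n where
  diagram := μ n
  entry c := if c ∈ μ n then birth μ c else 0
  bijOn := h.birth_bijOn.congr fun c (hc : c ∈ μ n) => (if_pos hc).symm
  row_lt {r s t} hst hc := by
    have hlt : (r, s) < (r, t) := Prod.mk_lt_mk_iff_right.2 hst
    have hmem : (r, s) ∈ μ n := (μ n).isLowerSet hlt.le hc
    rw [if_pos hc, if_pos hmem]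
    exact h.birth_strictMono hc hlt
  col_lt {q r s} hqr hc := by
    have hlt : (q, s) < (r, s) := Prod.mk_lt_mk_iff_left.2 hqr
    have hmem : (q, s) ∈ μ n := (μ n).isLowerSet hlt.le hc
    rw [if_pos hc, if_pos hmem]
    exact h.birth_strictMono hc hlt
  zeros _ hc := if_neg hc

theorem entry_tableau (h : IsGrowth n μ) (hc : c ∈ μ n) : h.tableau.entry c = birth μ c :=
  if_pos hc

end IsGrowth

namespace StandardTableau

theorem mem_sub (T : StandardTableau n) {k : ℕ} {c : ℕ × ℕ} :
    c ∈ T.sub k ↔ c ∈ T.diagram ∧ T.entry c ≤ k := by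
  rw [← YoungDiagram.mem_cells, sub, Finset.mem_filter, YoungDiagram.mem_cells]

theorem sub_self (T : StandardTableau n) : T.sub n = T.diagram := by
  ext c
  rw [YoungDiagram.mem_cells, T.mem_sub, YoungDiagram.mem_cells]
  exact and_iff_left_of_imp fun hc => (T.bijOn.mapsTo hc).2

theorem isGrowth_sub (T : StandardTableau n) : IsGrowth n T.sub := by
  constructor
  · refine (bot_unique fun c hc => absurd (T.mem_sub.1 hc).2 ?_)
    have := (T.bijOn.mapsTo (T.mem_sub.1 hc).1).1
    omega
  · intro k hk
    obtain ⟨c, hc, e⟩ := T.bijOn.surjOn (show k + 1 ∈ Set.Icc 1 n from ⟨by omega, hk⟩)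
    refine AddBox.covBy (a := c) ⟨fun h => by have := (T.mem_sub.1 h).2; omega, ?_⟩
    ext d
    rw [Finset.mem_insert, YoungDiagram.mem_cells, YoungDiagram.mem_cells, T.mem_sub, T.mem_sub,
      Nat.le_succ_iff_eq_or_le]
    constructor
    · rintro ⟨hd, he | hle⟩
      · exact Or.inl (T.bijOn.injOn hd hc (he.trans e.symm))
      · exact Or.inr ⟨hd, hle⟩
    · rintro (rfl | ⟨hd, hle⟩)
      · exact ⟨hc, Or.inl e⟩
      · exact ⟨hd, Or.inr hle⟩

end StandardTableau

theorem IsGrowth.encodes_tableau (h : IsGrowth n μ) : h.tableau.Encodes μ := by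
  intro k hk
  ext c
  rw [YoungDiagram.mem_cells, YoungDiagram.mem_cells, StandardTableau.mem_sub]
  constructor
  · rintro ⟨hc, hle⟩
    rw [h.entry_tableau hc] at hle
    exact (h.birth_le_iff hc hk).1 hle
  · intro hck
    have hc : c ∈ μ n := h.mono hk le_rfl hck
    refine ⟨hc, ?_⟩
    rw [h.entry_tableau hc]
    exact (h.birth_le_iff hc hk).2 hck

end Tableaux

section Words

variable {α β : Type*} [LinearOrder α] [LinearOrder β]

/-- The letters of `w` with a colour `< k` form `k` increasing subwords of `w`, one per colour.
All colours `≥ k` stand for uncoloured letters. -/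
def IsIncreasingColoring (k : ℕ) (w : List α) (g : α → ℕ) : Prop :=
  w.Pairwise fun x y => g x = g y → g x < k → x < y

/-- Greene's invariant: the maximal number of letters in a union of `k` increasing subwords
of `w`. -/
noncomputable def greeneNumber (k : ℕ) (w : List α) : ℕ :=
  sSup {m | ∃ g : α → ℕ, IsIncreasingColoring k w g ∧ w.countP (fun x => g x < k) = m}

theorem bddAbove_greeneNumber (k : ℕ) (w : List α) :
    BddAbove {m | ∃ g : α → ℕ, IsIncreasingColoring k w g ∧ w.countP (fun x => g x < k) = m} :=
  ⟨w.length, by rintro _ ⟨g, -, rfl⟩; exact List.countP_le_length⟩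

theorem IsIncreasingColoring.le_greeneNumber {k : ℕ} {w : List α} {g : α → ℕ}
    (h : IsIncreasingColoring k w g) : w.countP (fun x => g x < k) ≤ greeneNumber k w :=
  le_csSup (bddAbove_greeneNumber k w) ⟨g, h, rfl⟩

theorem exists_isIncreasingColoring (k : ℕ) (w : List α) :
    ∃ g : α → ℕ, IsIncreasingColoring k w g ∧ w.countP (fun x => g x < k) = greeneNumber k w := by
  refine Nat.sSup_mem (s := {m | ∃ g : α → ℕ, IsIncreasingColoring k w g ∧
    w.countP (fun x => g x < k) = m}) ⟨_, fun _ => k, ?_, rfl⟩ (bddAbove_greeneNumber k w)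
  exact List.pairwise_iff_forall_sublist.2 fun _ _ h => absurd h (lt_irrefl _)

theorem greeneNumber_le_iff {k m : ℕ} {w : List α} :
    greeneNumber k w ≤ m ↔
      ∀ g, IsIncreasingColoring k w g → w.countP (fun x => g x < k) ≤ m := by
  refine ⟨fun h g hg => hg.le_greeneNumber.trans h, fun h => ?_⟩
  obtain ⟨g, hg, e⟩ := exists_isIncreasingColoring k w
  exact e ▸ h g hg

theorem isIncreasingColoring_reverse_map_iff {f : α → β} (hf : StrictAnti f) {k : ℕ} {w : List α}
    {g : β → ℕ} :
    IsIncreasingColoring k (w.reverse.map f) g ↔ IsIncreasingColoring k w (g ∘ f) := by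
  unfold IsIncreasingColoring
  rw [List.pairwise_map, List.pairwise_reverse]
  simp only [hf.lt_iff_gt, Function.comp]
  constructor <;> exact List.Pairwise.imp fun h e => by simpa [e] using h e.symm

theorem greeneNumber_reverse_map {f : α → β} (hf : StrictAnti f) (k : ℕ) (w : List α) :
    greeneNumber k (w.reverse.map f) = greeneNumber k w := by
  have count : ∀ g : β → ℕ, (w.reverse.map f).countP (fun x => g x < k) =
      w.countP (fun x => (g ∘ f) x < k) := fun g => by
    rw [List.countP_map, List.countP_reverse]
    rfl
  apply le_antisymm <;> refine greeneNumber_le_iff.2 fun g hg => ?_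
  · rw [count]
    exact ((isIncreasingColoring_reverse_map_iff hf).1 hg).le_greeneNumber
  · have e : Function.extend f g 0 ∘ f = g := Function.extend_comp hf.injective g 0
    have hg' := (isIncreasingColoring_reverse_map_iff hf).2 (e.symm ▸ hg)
    simpa only [count, e] using hg'.le_greeneNumber

theorem greeneNumber_swap_le {k : ℕ} {a b : List α} {x z : α} (h : x < z) :
    greeneNumber k (a ++ [z, x] ++ b) ≤ greeneNumber k (a ++ [x, z] ++ b) := by
  refine greeneNumber_le_iff.2 fun g hg => ?_
  have hg' : IsIncreasingColoring k (a ++ [x, z] ++ b) g := by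
    simp only [IsIncreasingColoring, List.append_assoc, List.pairwise_append, List.pairwise_cons,
      List.cons_append, List.nil_append, List.mem_cons] at hg ⊢
    grind
  have perm : (a ++ [z, x] ++ b).Perm (a ++ [x, z] ++ b) :=
    ((List.Perm.swap x z []).append_left a).append_right b
  rw [perm.countP_eq]
  exact hg'.le_greeneNumber

section KnuthMove

variable {k : ℕ} {a b : List α} {x y z : α} {g : α → ℕ}

/-- If `y` has a colour, then the two increasing subwords through `y` and through `x`, `z` exchange
their tails, so that `y` is continued by `z`. -/
theorem IsIncreasingColoring.swap_tails (hg : IsIncreasingColoring k (a ++ [y, x, z] ++ b) g)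
    (hn : (a ++ [y, x, z] ++ b).Nodup) (hxy : x < y) (hyz : y < z) (hxz : g x = g z)
    (hx : g x < k) (hy : g y < k) :
    IsIncreasingColoring k (a ++ [y, z, x] ++ b)
      fun v => if v = z ∨ v ∈ b then Equiv.swap (g x) (g y) (g v) else g v := by
  simp only [IsIncreasingColoring, List.append_assoc, List.pairwise_append, List.pairwise_cons,
    List.cons_append, List.nil_append, List.mem_cons, List.nodup_append, List.nodup_cons]
    at hg hn ⊢
  obtain ⟨ha, ⟨hgy, hgx, hgz, hb⟩, hgab⟩ := hg
  obtain ⟨-, ⟨hny, hnx, -, -⟩, hnab⟩ := hn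
  have hne : g y ≠ g x := by grind
  simp only [Equiv.swap_apply_def]
  refine ⟨ha.imp_of_mem ?_, ⟨?_, ?_, ?_, hb.imp_of_mem ?_⟩, ?_⟩ <;> clear ha hb <;> intros <;> grind

/-- If `y` has no colour, then it replaces `x` in the increasing subword through `x` and `z`. -/
theorem IsIncreasingColoring.swap_letters (hg : IsIncreasingColoring k (a ++ [y, x, z] ++ b) g)
    (hn : (a ++ [y, x, z] ++ b).Nodup) (hxy : x < y) (hyz : y < z) (hxz : g x = g z)
    (hy : k ≤ g y) : IsIncreasingColoring k (a ++ [y, z, x] ++ b) (g ∘ Equiv.swap x y) := by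
  simp only [IsIncreasingColoring, List.append_assoc, List.pairwise_append, List.pairwise_cons,
    List.cons_append, List.nil_append, List.mem_cons, List.nodup_append, List.nodup_cons]
    at hg hn ⊢
  obtain ⟨ha, ⟨-, -, hgz, hb⟩, hgab⟩ := hg
  obtain ⟨-, ⟨hny, hnx, -, -⟩, hnab⟩ := hn
  simp only [Function.comp_apply, Equiv.swap_apply_def]
  refine ⟨ha.imp_of_mem ?_, ⟨?_, ?_, ?_, hb.imp_of_mem ?_⟩, ?_⟩ <;> clear ha hb <;> intros <;> grind

theorem countP_comp_swap {w : List α} (hw : w.Nodup) (hx : x ∈ w) (hy : y ∈ w) (p : α → Bool) :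
    w.countP (p ∘ Equiv.swap x y) = w.countP p := by
  have perm : (w.map (Equiv.swap x y)).Perm w := by
    rw [List.perm_ext_iff_of_nodup (hw.map (Equiv.swap x y).injective) hw]
    intro v
    rw [List.mem_map]
    grind
  rw [← List.countP_map, perm.countP_eq]

theorem greeneNumber_knuth_le (hxy : x < y) (hyz : y < z) (hn : (a ++ [y, x, z] ++ b).Nodup) :
    greeneNumber k (a ++ [y, x, z] ++ b) ≤ greeneNumber k (a ++ [y, z, x] ++ b) := by
  refine greeneNumber_le_iff.2 fun g hg => ?_
  have perm : (a ++ [y, x, z] ++ b).Perm (a ++ [y, z, x] ++ b) :=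
    (((List.Perm.swap z x []).cons y).append_left a).append_right b
  suffices ∃ g', IsIncreasingColoring k (a ++ [y, z, x] ++ b) g' ∧
      (a ++ [y, x, z] ++ b).countP (fun v => g v < k) =
        (a ++ [y, x, z] ++ b).countP (fun v => g' v < k) by
    obtain ⟨g', hg', e⟩ := this
    rw [e, perm.countP_eq]
    exact hg'.le_greeneNumber
  by_cases hxz : g x = g z ∧ g x < k
  · obtain ⟨hxz, hx⟩ := hxz
    rcases lt_or_ge (g y) k with hy | hy
    · refine ⟨_, hg.swap_tails hn hxy hyz hxz hx hy, List.countP_congr fun v _ => ?_⟩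
      simp only [decide_eq_true_eq, Equiv.swap_apply_def]
      grind
    · refine ⟨_, hg.swap_letters hn hxy hyz hxz hy, (countP_comp_swap hn ?_ ?_ _).symm⟩ <;> simp
  · refine ⟨g, ?_, rfl⟩
    simp only [IsIncreasingColoring, List.append_assoc, List.pairwise_append, List.pairwise_cons,
      List.cons_append, List.nil_append, List.mem_cons] at hg ⊢
    grind

theorem greeneNumber_dual_knuth_le (hxy : x < y) (hyz : y < z) (hn : (a ++ [x, z, y] ++ b).Nodup) :
    greeneNumber k (a ++ [x, z, y] ++ b) ≤ greeneNumber k (a ++ [z, x, y] ++ b) := by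
  have hdual : StrictAnti (OrderDual.toDual (α := α)) := fun _ _ h => h
  have hn' := (List.nodup_reverse.2 hn).map hdual.injective
  have := greeneNumber_knuth_le (k := k) (a := b.reverse.map OrderDual.toDual)
    (b := a.reverse.map OrderDual.toDual) (OrderDual.toDual_lt_toDual.2 hyz)
    (OrderDual.toDual_lt_toDual.2 hxy) (by simpa using hn')
  rw [← greeneNumber_reverse_map hdual, ← greeneNumber_reverse_map hdual k (a ++ [z, x, y] ++ b)]
  simpa using this

end KnuthMove

/-- The elementary Knuth transformations of words. -/
inductive KnuthStep : List α → List α → Prop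
  | left (a b : List α) {x y z : α} : x < y → y < z →
      KnuthStep (a ++ [y, x, z] ++ b) (a ++ [y, z, x] ++ b)
  | right (a b : List α) {x y z : α} : x < y → y < z →
      KnuthStep (a ++ [x, z, y] ++ b) (a ++ [z, x, y] ++ b)

/-- Knuth equivalence of words. -/
def KnuthEquiv : List α → List α → Prop :=
  Relation.EqvGen KnuthStep

theorem KnuthEquiv.refl (u : List α) : KnuthEquiv u u := Relation.EqvGen.refl u

namespace KnuthStep

variable {u v : List α}

theorem equiv (h : KnuthStep u v) : KnuthEquiv u v :=
  Relation.EqvGen.rel _ _ h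

theorem perm (h : KnuthStep u v) : u.Perm v := by
  cases h with
  | left a b => exact (((List.Perm.swap _ _ []).cons _).append_left a).append_right b
  | right a b => exact ((List.Perm.swap _ _ _).append_left a).append_right b

theorem append_append (h : KnuthStep u v) (c d : List α) :
    KnuthStep (c ++ u ++ d) (c ++ v ++ d) := by
  cases h with
  | left a b hxy hyz => simpa using left (c ++ a) (b ++ d) hxy hyz
  | right a b hxy hyz => simpa using right (c ++ a) (b ++ d) hxy hyz

theorem reverse (h : KnuthStep u v) : KnuthStep v.reverse u.reverse := by
  cases h with
  | left a b hxy hyz => simpa using right b.reverse a.reverse hxy hyz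
  | right a b hxy hyz => simpa using left b.reverse a.reverse hxy hyz

theorem greeneNumber_eq (h : KnuthStep u v) (hu : u.Nodup) (k : ℕ) :
    greeneNumber k u = greeneNumber k v := by
  cases h with
  | @left a b x y z hxy hyz =>
    refine le_antisymm (greeneNumber_knuth_le hxy hyz hu) ?_
    simpa using greeneNumber_swap_le (k := k) (a := a ++ [y]) (b := b) (hxy.trans hyz)
  | @right a b x y z hxy hyz =>
    refine le_antisymm (greeneNumber_dual_knuth_le hxy hyz hu) ?_
    simpa using greeneNumber_swap_le (k := k) (a := a) (b := y :: b) (hxy.trans hyz)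

theorem filter_lt (h : KnuthStep u v) (m : α) :
    KnuthEquiv (u.filter (· < m)) (v.filter (· < m)) := by
  rcases h with @⟨a, b, x, y, z, hxy, hyz⟩ | @⟨a, b, x, y, z, hxy, hyz⟩ <;> by_cases hz : z < m
  · simpa [hz, hyz.trans hz, (hxy.trans hyz).trans hz] using
      (left (a.filter (· < m)) (b.filter (· < m)) hxy hyz).equiv
  · simpa [List.filter_cons, hz] using KnuthEquiv.refl _
  · simpa [hz, hyz.trans hz, (hxy.trans hyz).trans hz] using
      (right (a.filter (· < m)) (b.filter (· < m)) hxy hyz).equiv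
  · simpa [List.filter_cons, hz] using KnuthEquiv.refl _

end KnuthStep

namespace KnuthEquiv

variable {u v w : List α}

theorem symm (h : KnuthEquiv u v) : KnuthEquiv v u := Relation.EqvGen.symm _ _ h

theorem trans (h : KnuthEquiv u v) (h' : KnuthEquiv v w) : KnuthEquiv u w :=
  Relation.EqvGen.trans _ _ _ h h'

theorem lift {f : List α → List β} (hf : ∀ u v, KnuthStep u v → KnuthEquiv (f u) (f v))
    (h : KnuthEquiv u v) : KnuthEquiv (f u) (f v) :=
  Setoid.eqvGen_le (s := (Relation.EqvGen.setoid KnuthStep).comap f) hf h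

theorem perm (h : KnuthEquiv u v) : u.Perm v :=
  Setoid.eqvGen_le (s := List.isSetoid α) (fun _ _ => KnuthStep.perm) h

theorem append_append (h : KnuthEquiv u v) (c d : List α) :
    KnuthEquiv (c ++ u ++ d) (c ++ v ++ d) :=
  h.lift (f := fun w => c ++ w ++ d) fun _ _ h => (h.append_append c d).equiv

theorem append_right (h : KnuthEquiv u v) (d : List α) : KnuthEquiv (u ++ d) (v ++ d) := by
  simpa using h.append_append [] d

theorem append_left (h : KnuthEquiv u v) (c : List α) : KnuthEquiv (c ++ u) (c ++ v) := by
  simpa using h.append_append c []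

theorem reverse (h : KnuthEquiv u v) : KnuthEquiv u.reverse v.reverse :=
  h.lift fun _ _ h => h.reverse.equiv.symm

theorem filter_lt (h : KnuthEquiv u v) (m : α) :
    KnuthEquiv (u.filter (· < m)) (v.filter (· < m)) :=
  h.lift fun _ _ h => h.filter_lt m

theorem greeneNumber_eq (h : KnuthEquiv u v) (hu : u.Nodup) (k : ℕ) :
    greeneNumber k u = greeneNumber k v := by
  induction h with
  | rel _ _ h => exact h.greeneNumber_eq hu k
  | refl _ => rfl
  | symm _ _ h ih => exact (ih ((perm h).nodup_iff.2 hu)).symm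
  | trans _ _ _ h _ ih₁ ih₂ => exact (ih₁ hu).trans (ih₂ ((perm h).nodup_iff.1 hu))

theorem cons_append_singleton {x y : α} (hx : x < y) {l : List α}
    (hl : (y :: l).Pairwise (· < ·)) : KnuthEquiv (y :: l ++ [x]) (y :: x :: l) := by
  induction l generalizing y with
  | nil => exact refl _
  | cons b l ih =>
    rw [List.pairwise_cons] at hl
    have hb := hl.1 b List.mem_cons_self
    refine ((ih (hx.trans hb) hl.2).append_left [y]).trans ?_
    simpa using (KnuthStep.left [] l hx hb).equiv.symm

theorem append_cons_cons {x y : α} (hx : x < y) {l : List α} (hl : (l ++ [x]).Pairwise (· < ·))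
    (r : List α) : KnuthEquiv (l ++ y :: x :: r) (y :: l ++ x :: r) := by
  induction l with
  | nil => exact refl _
  | cons a l ih =>
    rw [List.cons_append, List.pairwise_cons] at hl
    refine ((ih hl.2).append_left [a]).trans ?_
    cases l with
    | nil => simpa using (KnuthStep.right [] r (hl.1 x (by simp)) hx).equiv
    | cons b l =>
      have hbx : b < x := (List.pairwise_append.1 hl.2).2.2 b (by simp) x (by simp)
      simpa using (KnuthStep.right [] (l ++ x :: r) (hl.1 b (by simp)) (hbx.trans hx)).equiv

/-- Row insertion of `x` into the row `l ++ y :: r` bumps `y`. -/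
theorem bump {x y : α} (hx : x < y) {l r : List α} (hl : ∀ a ∈ l, a < x)
    (h : (l ++ y :: r).Pairwise (· < ·)) :
    KnuthEquiv (l ++ y :: r ++ [x]) (y :: l ++ x :: r) := by
  rw [List.pairwise_append] at h
  rw [List.append_assoc]
  refine ((cons_append_singleton hx h.2.1).append_left l).trans (append_cons_cons hx ?_ r)
  rw [List.pairwise_append]
  exact ⟨h.1, by simp, by simpa using hl⟩

end KnuthEquiv

/-- The row reading word of a list of rows, from the last row to the first. -/
def tabWord : List (List α) → List α
  | [] => []
  | R :: T => tabWord T ++ R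

/-- The row `S` fits below the row `R`: columns increase strictly. -/
def FitsBelow : List α → List α → Prop
  | _, [] => True
  | [], _ :: _ => False
  | r :: R, s :: S => r < s ∧ FitsBelow R S

/-- A list of rows is a tableau: rows and columns increase strictly. Rows may be empty. -/
def IsTab : List (List α) → Prop
  | [] => True
  | R :: T => R.Pairwise (· < ·) ∧ FitsBelow R (T.headD []) ∧ IsTab T

/-- `RowInsert T x T' r`: row insertion of `x` into the tableau `T` gives `T'`, with one more letter
in row `r`. -/
inductive RowInsert : List (List α) → α → List (List α) → ℕ → Prop
  | nil (x : α) : RowInsert [] x [[x]] 0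
  | last {R : List α} (T : List (List α)) {x : α} :
      (∀ a ∈ R, a < x) → RowInsert (R :: T) x ((R ++ [x]) :: T) 0
  | bump {T U : List (List α)} {l : List α} {x y : α} (s : List α) {r : ℕ} :
      (∀ a ∈ l, a < x) → x < y → RowInsert T y U r →
      RowInsert ((l ++ y :: s) :: T) x ((l ++ x :: s) :: U) (r + 1)

/-- `AddMax T m U r`: the list of rows `U` arises from `T` by appending `m` to row `r`. -/
inductive AddMax : List (List α) → α → List (List α) → ℕ → Prop
  | nil (m : α) : AddMax [] m [[m]] 0
  | head (R : List α) (T : List (List α)) (m : α) : AddMax (R :: T) m ((R ++ [m]) :: T) 0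
  | tail (R : List α) {T U : List (List α)} {m : α} {r : ℕ} :
      AddMax T m U r → AddMax (R :: T) m (R :: U) (r + 1)

theorem fitsBelow_nil (R : List α) : FitsBelow R [] := by
  cases R <;> trivial

namespace FitsBelow

variable {R S l s l' s' : List α} {x y z m : α}

theorem append (h : FitsBelow R S) (l : List α) : FitsBelow (R ++ l) S := by
  fun_induction FitsBelow R S <;> grind [FitsBelow]

theorem of_append (h : FitsBelow R (S ++ l)) : FitsBelow R S := by
  fun_induction FitsBelow R S <;> grind [FitsBelow]

theorem of_append_max (h : FitsBelow (R ++ [m]) S) (hS : ∀ s ∈ S, s < m) : FitsBelow R S := by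
  fun_induction FitsBelow R S with
  | case1 => trivial
  | case2 t S => exact absurd h.1 (hS t List.mem_cons_self).asymm
  | case3 r R t S ih => exact ⟨h.1, ih h.2 (List.forall_mem_cons.1 hS).2⟩

theorem replace (h : FitsBelow (l ++ y :: s) S) (hx : x < y) : FitsBelow (l ++ x :: s) S := by
  fun_induction FitsBelow l S <;> grind [FitsBelow]

theorem getElem_lt (h : FitsBelow R S) (i : ℕ) (hi : i < S.length) :
    ∃ h' : i < R.length, R[i] < S[i] := by
  fun_induction FitsBelow R S generalizing i with
  | case1 => simp at hi
  | case2 => exact h.elim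
  | case3 r R s S ih => cases i <;> simp_all

theorem length_le (h : FitsBelow R S) : S.length ≤ R.length := by
  fun_induction FitsBelow R S <;> grind

theorem bump_last (h : FitsBelow (l ++ y :: s) S) (hl : ∀ a ∈ l, a < x) (hx : x < y)
    (hS : ∀ a ∈ S, a < y) : FitsBelow (l ++ x :: s) (S ++ [y]) := by
  fun_induction FitsBelow l S with
  | case1 R =>
    cases R with
    | nil => exact ⟨hx, fitsBelow_nil s⟩
    | cons r R => exact ⟨(hl r List.mem_cons_self).trans hx, fitsBelow_nil _⟩
  | case2 t S => exact absurd h.1 (hS t List.mem_cons_self).asymm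
  | case3 r R t S ih =>
    rw [List.forall_mem_cons] at hl hS
    exact ⟨h.1, ih h.2 hl.2 hS.2⟩

theorem bump_bump (h : FitsBelow (l ++ y :: s) (l' ++ z :: s')) (hl : ∀ a ∈ l, a < x) (hx : x < y)
    (hl' : ∀ a ∈ l', a < y) : FitsBelow (l ++ x :: s) (l' ++ y :: s') := by
  fun_induction FitsBelow l l' with
  | case1 R =>
    cases R with
    | nil => exact ⟨hx, h.2⟩
    | cons r R => exact ⟨(hl r List.mem_cons_self).trans hx, h.2.replace hx⟩
  | case2 t S => exact absurd h.1 (hl' t List.mem_cons_self).asymm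
  | case3 r R t S ih =>
    rw [List.forall_mem_cons] at hl hl'
    exact ⟨h.1, ih h.2 hl.2 hl'.2⟩

end FitsBelow

theorem exists_split_of_pairwise {R : List α} (hR : R.Pairwise (· < ·)) {x : α} (hx : x ∉ R) :
    (∀ a ∈ R, a < x) ∨ ∃ l y s, R = l ++ y :: s ∧ (∀ a ∈ l, a < x) ∧ x < y := by
  induction R with
  | nil => simp
  | cons r R ih =>
    rw [List.pairwise_cons] at hR
    rw [List.mem_cons, not_or] at hx
    rcases lt_or_gt_of_ne hx.1 with h | h
    · exact .inr ⟨[], r, R, rfl, by simp, h⟩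
    · rcases ih hR.2 hx.2 with h' | ⟨l, y, s, rfl, h₁, h₂⟩
      · exact .inl (by simpa [h] using h')
      · exact .inr ⟨r :: l, y, s, rfl, by simpa [h] using h₁, h₂⟩

namespace RowInsert

variable {T T' : List (List α)} {x : α} {r : ℕ}

theorem exists_rowInsert (hT : IsTab T) (hx : x ∉ tabWord T) (hn : (tabWord T).Nodup) :
    ∃ T' r, RowInsert T x T' r := by
  induction T generalizing x with
  | nil => exact ⟨_, _, .nil x⟩
  | cons R T ih =>
    simp only [tabWord, List.mem_append, not_or, List.nodup_append] at hx hn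
    rcases exists_split_of_pairwise hT.1 hx.2 with h | ⟨l, y, s, rfl, hl, hy⟩
    · exact ⟨_, _, .last T h⟩
    · obtain ⟨T', r, h⟩ := ih hT.2.2 (fun h => hn.2.2 y h y (by simp) rfl) hn.1
      exact ⟨_, _, .bump s hl hy h⟩

theorem isTab (h : RowInsert T x T' r) (hT : IsTab T) : IsTab T' := by
  induction h with
  | nil => simp [IsTab, fitsBelow_nil]
  | last T h => exact ⟨by simpa [List.pairwise_append, hT.1] using h, hT.2.1.append _, hT.2.2⟩
  | @bump T T' l x y s r hl hy h ih =>
    refine ⟨?_, ?_, ih hT.2.2⟩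
    · have hR := hT.1
      rw [List.pairwise_append, List.pairwise_cons] at hR ⊢
      refine ⟨hR.1, ⟨fun a ha => hy.trans (hR.2.1.1 a ha), hR.2.1.2⟩, fun a ha => ?_⟩
      rw [List.forall_mem_cons]
      exact ⟨hl a ha, fun b hb => hR.2.2 a ha b (List.mem_cons_of_mem y hb)⟩
    · cases h with
      | nil => exact FitsBelow.bump_last (S := []) (fitsBelow_nil _) hl hy (by simp)
      | last T h => exact hT.2.1.bump_last hl hy h
      | bump s' hl' _ _ => exact FitsBelow.bump_bump hT.2.1 hl hy hl'

theorem knuthEquiv (h : RowInsert T x T' r) (hT : IsTab T) :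
    KnuthEquiv (tabWord T ++ [x]) (tabWord T') := by
  induction h with
  | nil x => exact .refl _
  | last => simpa [tabWord] using KnuthEquiv.refl _
  | @bump T T' l x y s _ hl hy _ ih =>
    have bump_out := (KnuthEquiv.bump hy hl hT.1).append_left (tabWord T)
    have insert_below := (ih hT.2.2).append_right (l ++ x :: s)
    simp only [tabWord, List.append_assoc, List.cons_append, List.nil_append]
      at bump_out insert_below ⊢
    exact bump_out.trans insert_below

theorem length_getD (h : RowInsert T x T' r) (i : ℕ) :
    (T'.getD i []).length = (T.getD i []).length + if i = r then 1 else 0 := by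
  induction h generalizing i with
  | nil => cases i <;> simp
  | last => cases i <;> simp
  | bump _ _ _ _ ih => cases i with
    | zero => simp
    | succ i => simpa using ih i

end RowInsert

theorem exists_isTab_knuthEquiv (w : List α) (hw : w.Nodup) :
    ∃ T, IsTab T ∧ KnuthEquiv w (tabWord T) := by
  induction w using List.reverseRecOn with
  | nil => exact ⟨[], trivial, .refl _⟩
  | append_singleton w x ih =>
    rw [List.nodup_append] at hw
    obtain ⟨T, hT, h⟩ := ih hw.1
    obtain ⟨T', r, hi⟩ := RowInsert.exists_rowInsert hT (x := x)
      (fun hx => hw.2.2 x (h.perm.mem_iff.2 hx) x (by simp) rfl) (h.perm.nodup_iff.1 hw.1)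
    exact ⟨T', hi.isTab hT, (h.append_right _).trans (hi.knuthEquiv hT)⟩

namespace AddMax

variable {T U W : List (List α)} {x m : α} {r : ℕ}

theorem length_getD {γ : Type*} {T U : List (List γ)} {m : γ} (h : AddMax T m U r)
    (i : ℕ) :
    (U.getD i []).length = (T.getD i []).length + if i = r then 1 else 0 := by
  induction h generalizing i with
  | nil => cases i <;> simp
  | head => cases i <;> simp
  | tail _ _ ih => cases i with
    | zero => simp
    | succ i => simpa using ih i

theorem fitsBelow_headD {R : List α} (h : AddMax T m U r) (hR : FitsBelow R (U.headD [])) :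
    FitsBelow R (T.headD []) := by
  cases h with
  | nil => exact fitsBelow_nil R
  | head S T m => exact FitsBelow.of_append hR
  | tail S h => exact hR

theorem rowInsert (hU : AddMax T m U r) (h : RowInsert T x W r) (hT : ∀ a ∈ tabWord T, a < m)
    (hx : x < m) : ∃ W', RowInsert U x W' (r + 1) := by
  induction h generalizing U with
  | nil x =>
    cases hU
    exact ⟨_, .bump (l := []) [] (by simp) hx (.nil m)⟩
  | @last R T x h =>
    cases hU
    have append_next : ∃ W', RowInsert T m W' 0 := by
      cases T with
      | nil => exact ⟨_, .nil m⟩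
      | cons S T => exact ⟨_, .last T fun a ha => hT a (by simp [tabWord, ha])⟩
    obtain ⟨W', hW⟩ := append_next
    exact ⟨_, .bump [] h hx hW⟩
  | bump s hl hy _ ih =>
    cases hU with
    | tail _ hU =>
      obtain ⟨W', hW⟩ := ih hU (fun a ha => hT a (by simp [tabWord, ha])) (hT _ (by simp [tabWord]))
      exact ⟨_, .bump s hl hy hW⟩

end AddMax

theorem exists_eq_append_of_pairwise {R : List α} (hR : R.Pairwise (· < ·)) {m : α} (hm : m ∈ R)
    (hmax : ∀ a ∈ R, a ≤ m) : ∃ l, R = l ++ [m] ∧ ∀ a ∈ l, a < m := by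
  obtain ⟨l, s, rfl⟩ := List.append_of_mem hm
  rw [List.pairwise_append, List.pairwise_cons] at hR
  have hs : s = [] := List.eq_nil_iff_forall_not_mem.2 fun a ha =>
    (hmax a (by simp [ha])).not_gt (hR.2.1.1 a ha)
  exact ⟨l, by rw [hs], fun a ha => hR.2.2 a ha m List.mem_cons_self⟩

theorem mem_tabWord_of_mem_headD {γ : Type*} {T : List (List γ)} {a : γ} (h : a ∈ T.headD []) :
    a ∈ tabWord T := by
  cases T with
  | nil => simp at h
  | cons R T => exact List.mem_append_right _ h

theorem exists_addMax {U : List (List α)} (hU : IsTab U) (hn : (tabWord U).Nodup) {m : α}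
    (hm : m ∈ tabWord U) (hmax : ∀ a ∈ tabWord U, a ≤ m) :
    ∃ T r, IsTab T ∧ AddMax T m U r ∧ tabWord T = (tabWord U).filter (· < m) := by
  induction U with
  | nil => simp [tabWord] at hm
  | cons R U ih =>
    obtain ⟨hR, hRU, hU⟩ := hU
    rw [tabWord, List.nodup_append] at hn
    simp only [tabWord, List.mem_append, or_imp, forall_and] at hm hmax
    by_cases hmR : m ∈ R
    · obtain ⟨l, rfl, hl⟩ := exists_eq_append_of_pairwise hR hmR hmax.2
      have hlt : ∀ a ∈ tabWord U, a < m := fun a ha =>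
        (hmax.1 a ha).lt_of_ne (hn.2.2 a ha m (by simp))
      refine ⟨l :: U, 0, ⟨(List.pairwise_append.1 hR).1, ?_, hU⟩, .head l U m, ?_⟩
      · exact hRU.of_append_max fun a ha => hlt a (mem_tabWord_of_mem_headD ha)
      · have hlt' := List.filter_eq_self (p := (· < m)) |>.2 (by simpa using hlt)
        have hl' := List.filter_eq_self (p := (· < m)) |>.2 (by simpa using hl)
        simp [tabWord, List.filter_append, hlt', hl']
    · obtain ⟨T, r, hT, h, e⟩ := ih hU hn.1 (hm.resolve_right hmR) hmax.1
      have hR' : R.filter (· < m) = R := List.filter_eq_self.2 fun a ha => by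
        simpa using (hmax.2 a ha).lt_of_ne (ne_of_mem_of_not_mem ha hmR)
      refine ⟨R :: T, r + 1, ⟨hR, h.fitsBelow_headD hRU, hT⟩, h.tail R, ?_⟩
      rw [tabWord, tabWord, List.filter_append, e, hR']

theorem sum_rowLen_eq_card (μ : YoungDiagram) (k : ℕ) :
    ∑ i ∈ Finset.range k, μ.rowLen i = (μ.cells.filter fun c => c.1 < k).card := by
  rw [Finset.card_eq_sum_card_fiberwise (f := Prod.fst) (t := Finset.range k)
    fun c hc => by simpa using (Finset.mem_filter.1 hc).2]
  refine Finset.sum_congr rfl fun i hi => ?_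
  rw [YoungDiagram.rowLen_eq_card, YoungDiagram.row, Finset.filter_filter]
  congr 1
  grind

theorem card_filter_snd_eq (μ : YoungDiagram) (k j : ℕ) :
    (μ.cells.filter fun c => c.1 < k ∧ c.2 = j).card = min k (μ.colLen j) := by
  have e : (μ.cells.filter fun c => c.1 < k ∧ c.2 = j) =
      Finset.range (min k (μ.colLen j)) ×ˢ {j} := by
    ext ⟨a, b⟩
    simp only [Finset.mem_filter, YoungDiagram.mem_cells, Finset.mem_product, Finset.mem_range,
      Finset.mem_singleton, YoungDiagram.mem_iff_lt_colLen, lt_min_iff]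
    grind
  rw [e, Finset.card_product, Finset.card_range, Finset.card_singleton, mul_one]

theorem sum_rowLen_eq_sum_min (μ : YoungDiagram) (k : ℕ) :
    ∑ i ∈ Finset.range k, μ.rowLen i = ∑ j ∈ μ.cells.image Prod.snd, min k (μ.colLen j) := by
  rw [sum_rowLen_eq_card, Finset.card_eq_sum_card_fiberwise (f := Prod.snd)
    (t := μ.cells.image Prod.snd)
    fun c hc => Finset.mem_image_of_mem _ (Finset.mem_filter.1 hc).1]
  simp only [Finset.filter_filter, card_filter_snd_eq]

theorem countP_eq_card_filter {w : List α} (hw : w.Nodup) (p : α → Prop) [DecidablePred p] :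
    w.countP (fun x => p x) = (w.toFinset.filter p).card := by
  rw [List.countP_eq_length_filter, ← List.toFinset_card_of_nodup (hw.filter _),
    List.toFinset_filter]
  simp only [decide_eq_true_eq]

/-- The letters of `w` are placed bijectively on the cells of `μ`, such that `w` runs through every
row increasingly and through every column decreasingly. -/
structure IsPlacement (w : List α) (μ : YoungDiagram) (pos : α → ℕ × ℕ) : Prop where
  bijOn : Set.BijOn pos {x | x ∈ w} μ.cells
  row : w.Pairwise fun x y => (pos x).1 = (pos y).1 → x < y
  col : w.Pairwise fun x y => (pos x).2 = (pos y).2 → y < x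

/-- The conclusion of Greene's theorem for the word `w` and the diagram `μ`, for increasing and for
decreasing subwords. -/
structure HasShape (w : List α) (μ : YoungDiagram) : Prop where
  greeneNumber_eq : ∀ k, greeneNumber k w = ∑ i ∈ Finset.range k, μ.rowLen i
  greeneNumber_reverse_eq : ∀ k, greeneNumber k w.reverse = ∑ j ∈ Finset.range k, μ.colLen j

namespace IsPlacement

variable {w : List α} {μ : YoungDiagram} {pos : α → ℕ × ℕ}

theorem nodup (h : IsPlacement w μ pos) : w.Nodup :=
  h.row.imp fun h e => (h (congrArg (fun x => (pos x).1) e)).ne e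

theorem cells_eq_image (h : IsPlacement w μ pos) : μ.cells = w.toFinset.image pos := by
  rw [← Finset.coe_inj, ← h.bijOn.image_eq, Finset.coe_image, List.coe_toFinset]

theorem reverse (h : IsPlacement w μ pos) :
    IsPlacement w.reverse μ.transpose fun x => (pos x).swap where
  bijOn := by
    have swap : Set.BijOn (Equiv.prodComm ℕ ℕ) μ.cells μ.transpose.cells :=
      Equiv.bijOn _ fun c => by simp
    simp only [List.mem_reverse]
    exact swap.comp h.bijOn
  row := List.pairwise_reverse.2 <| h.col.imp fun h e => h e.symm
  col := List.pairwise_reverse.2 <| h.row.imp fun h e => h e.symm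

theorem countP_row_lt (h : IsPlacement w μ pos) (k : ℕ) :
    w.countP (fun x => (pos x).1 < k) = ∑ i ∈ Finset.range k, μ.rowLen i := by
  rw [countP_eq_card_filter h.nodup, sum_rowLen_eq_card, h.cells_eq_image, Finset.filter_image,
    Finset.card_image_of_injOn]
  exact h.bijOn.injOn.mono fun x hx => by simpa using (Finset.mem_filter.1 hx).1

theorem card_coloured_col_le (h : IsPlacement w μ pos) {k : ℕ} {g : α → ℕ}
    (hg : IsIncreasingColoring k w g) (j : ℕ) :
    (w.toFinset.filter fun x => g x < k ∧ (pos x).2 = j).card ≤ min k (μ.colLen j) := by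
  have mem : ∀ {x}, x ∈ ((w.toFinset.filter fun x => g x < k ∧ (pos x).2 = j : Finset α) : Set α) →
      x ∈ w ∧ g x < k ∧ (pos x).2 = j := by simp
  refine le_min ?_ ?_
  · have ne_of_col_eq : w.Pairwise fun x y => (pos x).2 = (pos y).2 → g x < k → g x ≠ g y :=
      (hg.and h.col).imp fun h hc hk e => (h.1 e hk).asymm (h.2 hc)
    refine (Finset.card_le_card_of_injOn g (fun x hx => ?_) fun x hx y hy e => ?_).trans
      (Finset.card_range k).le
    · simpa using (mem hx).2.1
    · have : Std.Symm fun x y => (pos x).2 = (pos y).2 → g x < k → g x ≠ g y :=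
        ⟨fun x y h hc hk e => h hc.symm (e ▸ hk) e.symm⟩
      by_contra hne
      exact ne_of_col_eq.forall (mem hx).1 (mem hy).1 hne
        ((mem hx).2.2.trans (mem hy).2.2.symm) (mem hx).2.1 e
  · refine (Finset.card_le_card_of_injOn (fun x => (pos x).1) (fun x hx => ?_)
      fun x hx y hy e => ?_).trans (Finset.card_range (μ.colLen j)).le
    · obtain ⟨hxw, -, rfl⟩ := mem hx
      exact Finset.mem_coe.2 <| Finset.mem_range.2 <|
        YoungDiagram.mem_iff_lt_colLen.1 (h.bijOn.mapsTo hxw)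
    · exact h.bijOn.injOn (mem hx).1 (mem hy).1
        (Prod.ext e ((mem hx).2.2.trans (mem hy).2.2.symm))

theorem greeneNumber_eq (h : IsPlacement w μ pos) (k : ℕ) :
    greeneNumber k w = ∑ i ∈ Finset.range k, μ.rowLen i := by
  apply le_antisymm
  · refine greeneNumber_le_iff.2 fun g hg => ?_
    rw [countP_eq_card_filter h.nodup, sum_rowLen_eq_sum_min,
      Finset.card_eq_sum_card_fiberwise (f := fun x => (pos x).2) (t := μ.cells.image Prod.snd)
        fun x hx => Finset.mem_image_of_mem _
          (h.bijOn.mapsTo (List.mem_toFinset.1 (Finset.mem_filter.1 hx).1))]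
    simp only [Finset.filter_filter]
    exact Finset.sum_le_sum fun j _ => h.card_coloured_col_le hg j
  · rw [← h.countP_row_lt]
    exact IsIncreasingColoring.le_greeneNumber (h.row.imp fun h e _ => h e)

theorem hasShape (h : IsPlacement w μ pos) : HasShape w μ :=
  ⟨h.greeneNumber_eq, by simpa using h.reverse.greeneNumber_eq⟩

end IsPlacement

namespace HasShape

variable {u v w : List α} {μ ν : YoungDiagram}

theorem unique (h : HasShape w μ) (h' : HasShape w ν) : μ = ν :=
  eq_of_rowLen_eq fun k => by
    have hk := (h.greeneNumber_eq k).symm.trans (h'.greeneNumber_eq k)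
    have hk' := (h.greeneNumber_eq (k + 1)).symm.trans (h'.greeneNumber_eq (k + 1))
    simpa [Finset.sum_range_succ, hk] using hk'

theorem reverse (h : HasShape w μ) : HasShape w.reverse μ.transpose :=
  ⟨by simpa using h.greeneNumber_reverse_eq, by simpa using h.greeneNumber_eq⟩

theorem congr (h : HasShape u μ) (hu : u.Nodup) (e : KnuthEquiv u v) : HasShape v μ where
  greeneNumber_eq k := (e.greeneNumber_eq hu k).symm.trans (h.greeneNumber_eq k)
  greeneNumber_reverse_eq k :=
    (e.reverse.greeneNumber_eq (List.nodup_reverse.2 hu) k).symm.trans (h.greeneNumber_reverse_eq k)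

end HasShape

theorem IsTab.sortedGE_map_length {T : List (List α)} (hT : IsTab T) :
    (T.map List.length).SortedGE := by
  rw [List.sortedGE_iff_isChain]
  induction T with
  | nil => simp
  | cons R T ih =>
    cases T with
    | nil => simp
    | cons S T => exact (ih hT.2.2).cons_cons hT.2.1.length_le

/-- The Young diagram formed by the rows of a tableau. -/
def tabShape (T : List (List α)) (hT : IsTab T) : YoungDiagram :=
  .ofRowLens (T.map List.length) hT.sortedGE_map_length

theorem mem_tabShape {T : List (List α)} {hT : IsTab T} {c : ℕ × ℕ} :
    c ∈ tabShape T hT ↔ c.2 < (T.getD c.1 []).length := by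
  rw [tabShape, YoungDiagram.mem_ofRowLens]
  grind

theorem rowLen_tabShape {T : List (List α)} (hT : IsTab T) (i : ℕ) :
    (tabShape T hT).rowLen i = (T.getD i []).length :=
  eq_of_forall_lt_iff fun j => by rw [← YoungDiagram.mem_iff_lt_rowLen, mem_tabShape]

/-- The cell of a letter of a tableau. -/
def tabPos : List (List α) → α → ℕ × ℕ
  | [], _ => 0
  | R :: T, x => if x ∈ R then (0, R.idxOf x) else ((tabPos T x).1 + 1, (tabPos T x).2)

section TabPos

variable {R : List α} {T : List (List α)} {x : α}

theorem tabPos_of_mem (h : x ∈ R) : tabPos (R :: T) x = (0, R.idxOf x) := if_pos h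

theorem tabPos_of_notMem (h : x ∉ R) :
    tabPos (R :: T) x = ((tabPos T x).1 + 1, (tabPos T x).2) := if_neg h

theorem getElem?_tabPos (hx : x ∈ tabWord T) :
    (T.getD (tabPos T x).1 [])[(tabPos T x).2]? = some x := by
  induction T with
  | nil => simp [tabWord] at hx
  | cons R T ih =>
    by_cases h : x ∈ R
    · simp [tabPos, h]
    · simp only [tabWord, List.mem_append, h, or_false] at hx
      simpa [tabPos, h] using ih hx

theorem exists_tabPos_eq (hn : (tabWord T).Nodup) {i j : ℕ} (h : j < (T.getD i []).length) :
    ∃ x ∈ tabWord T, tabPos T x = (i, j) := by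
  induction T generalizing i with
  | nil => simp at h
  | cons R T ih =>
    rw [tabWord, List.nodup_append] at hn
    cases i with
    | zero =>
      have h : j < R.length := by simpa using h
      exact ⟨R[j], by simp [tabWord], by simp [tabPos, hn.2.1.idxOf_getElem]⟩
    | succ i =>
      obtain ⟨x, hx, e⟩ := ih hn.1 (i := i) (by simpa using h)
      have hxR : x ∉ R := fun h => hn.2.2 x hx x h rfl
      exact ⟨x, by simp [tabWord, hx], by rw [tabPos_of_notMem hxR, e]⟩

theorem bijOn_tabPos (hT : IsTab T) (hn : (tabWord T).Nodup) :
    Set.BijOn (tabPos T) {x | x ∈ tabWord T} (tabShape T hT).cells := by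
  refine ⟨fun x hx => ?_, fun x hx y hy h => ?_, fun c hc => ?_⟩
  · rw [Finset.mem_coe, YoungDiagram.mem_cells, mem_tabShape]
    exact (List.getElem?_eq_some_iff.1 (getElem?_tabPos hx)).1
  · exact Option.some.inj (by rw [← getElem?_tabPos hx, h, getElem?_tabPos hy])
  · rw [Finset.mem_coe, YoungDiagram.mem_cells, mem_tabShape] at hc
    exact exists_tabPos_eq hn hc

theorem exists_getElem_head_lt (hT : IsTab (R :: T)) (hx : x ∈ tabWord T) :
    ∃ h : (tabPos T x).2 < R.length, R[(tabPos T x).2] < x := by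
  induction T generalizing R with
  | nil => simp [tabWord] at hx
  | cons S T ih =>
    have hRS : FitsBelow R S := hT.2.1
    by_cases h : x ∈ S
    · obtain ⟨hR, hlt⟩ := hRS.getElem_lt (S.idxOf x) (List.idxOf_lt_length_of_mem h)
      simp only [tabPos_of_mem h]
      exact ⟨hR, by simpa using hlt⟩
    · simp only [tabWord, List.mem_append, h, or_false] at hx
      obtain ⟨hS, hlt⟩ := ih hT.2.2 hx
      obtain ⟨hR, hlt'⟩ := hRS.getElem_lt _ hS
      simp only [tabPos_of_notMem h]
      exact ⟨hR, hlt'.trans hlt⟩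

theorem pairwise_row_tabPos (hT : IsTab T) (hn : (tabWord T).Nodup) :
    (tabWord T).Pairwise fun x y => (tabPos T x).1 = (tabPos T y).1 → x < y := by
  induction T with
  | nil => simp [tabWord]
  | cons R T ih =>
    rw [tabWord, List.nodup_append] at hn
    have notMem : ∀ x ∈ tabWord T, x ∉ R := fun x hx h => hn.2.2 x hx x h rfl
    refine List.pairwise_append.2 ⟨(ih hT.2.2 hn.1).imp_of_mem fun hx hy h e => ?_,
      hT.1.imp_of_mem fun _ _ h _ => h, fun x hx y hy e => ?_⟩
    · rw [tabPos_of_notMem (notMem _ hx), tabPos_of_notMem (notMem _ hy)] at e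
      exact h (Nat.succ_injective e)
    · rw [tabPos_of_notMem (notMem _ hx), tabPos_of_mem hy] at e
      exact absurd e (Nat.succ_ne_zero _)

theorem pairwise_col_tabPos (hT : IsTab T) (hn : (tabWord T).Nodup) :
    (tabWord T).Pairwise fun x y => (tabPos T x).2 = (tabPos T y).2 → y < x := by
  induction T with
  | nil => simp [tabWord]
  | cons R T ih =>
    rw [tabWord, List.nodup_append] at hn
    have notMem : ∀ x ∈ tabWord T, x ∉ R := fun x hx h => hn.2.2 x hx x h rfl
    refine List.pairwise_append.2 ⟨(ih hT.2.2 hn.1).imp_of_mem fun hx hy h e => ?_,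
      hT.1.imp_of_mem fun hx hy h e => ?_, fun x hx y hy e => ?_⟩
    · rw [tabPos_of_notMem (notMem _ hx), tabPos_of_notMem (notMem _ hy)] at e
      exact h e
    · rw [tabPos_of_mem hx, tabPos_of_mem hy] at e
      exact absurd ((List.idxOf_inj hx).1 e) h.ne
    · rw [tabPos_of_notMem (notMem _ hx), tabPos_of_mem hy] at e
      obtain ⟨_, hlt⟩ := exists_getElem_head_lt hT hx
      simpa [show (tabPos T x).2 = R.idxOf y from e] using hlt

theorem IsTab.hasShape (hT : IsTab T) (hn : (tabWord T).Nodup) :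
    HasShape (tabWord T) (tabShape T hT) :=
  IsPlacement.hasShape (pos := tabPos T)
    ⟨bijOn_tabPos hT hn, pairwise_row_tabPos hT hn, pairwise_col_tabPos hT hn⟩

end TabPos

open Classical in
/-- The shape of a word without repeated letters. The empty diagram is a junk value for words which
do not satisfy Greene's theorem. -/
noncomputable def wordShape (w : List α) : YoungDiagram :=
  if h : ∃ μ, HasShape w μ then h.choose else ⊥

section WordShape

variable {u v w : List α} {μ : YoungDiagram} {T U : List (List α)} {x m : α} {c d : ℕ × ℕ}

theorem HasShape.wordShape_eq (h : HasShape w μ) : wordShape w = μ := by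
  have h' : ∃ μ, HasShape w μ := ⟨μ, h⟩
  rw [wordShape, dif_pos h']
  exact h'.choose_spec.unique h

theorem hasShape_wordShape (hw : w.Nodup) : HasShape w (wordShape w) := by
  obtain ⟨T, hT, h⟩ := exists_isTab_knuthEquiv w hw
  have hTn := h.perm.nodup_iff.1 hw
  have hasShape : HasShape w (tabShape T hT) := (hT.hasShape hTn).congr hTn h.symm
  rwa [hasShape.wordShape_eq]

theorem wordShape_nil : wordShape ([] : List α) = ⊥ :=
  (IsTab.hasShape (T := []) trivial List.nodup_nil).wordShape_eq

theorem wordShape_reverse (hw : w.Nodup) : wordShape w.reverse = (wordShape w).transpose :=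
  (hasShape_wordShape hw).reverse.wordShape_eq

theorem wordShape_reverse_map {f : α → β} (hf : StrictAnti f) (hw : w.Nodup) :
    wordShape (w.reverse.map f) = wordShape w := by
  refine HasShape.wordShape_eq ⟨fun k => ?_, fun k => ?_⟩
  · rw [greeneNumber_reverse_map hf, (hasShape_wordShape hw).greeneNumber_eq]
  · rw [← List.map_reverse, greeneNumber_reverse_map hf,
      (hasShape_wordShape hw).greeneNumber_reverse_eq]

theorem KnuthEquiv.wordShape_eq (h : KnuthEquiv u v) (hu : u.Nodup) : wordShape u = wordShape v :=
  ((hasShape_wordShape hu).congr hu h).wordShape_eq.symm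

theorem KnuthEquiv.rowLen_wordShape (h : KnuthEquiv w (tabWord T)) (hw : w.Nodup) (hT : IsTab T)
    (i : ℕ) : (wordShape w).rowLen i = (T.getD i []).length := by
  rw [h.wordShape_eq hw, (hT.hasShape (h.perm.nodup_iff.1 hw)).wordShape_eq, rowLen_tabShape]

theorem RowInsert.addBox_wordShape {T' : List (List α)} {r : ℕ} (h : RowInsert T x T' r)
    (hT : IsTab T) (e : KnuthEquiv w (tabWord T)) (hw : (w ++ [x]).Nodup) :
    AddBox (wordShape w) (r, (wordShape w).rowLen r) (wordShape (w ++ [x])) :=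
  AddBox.of_rowLen fun i => by
    rw [e.rowLen_wordShape hw.of_append_left hT,
      ((e.append_right _).trans (h.knuthEquiv hT)).rowLen_wordShape hw (h.isTab hT), h.length_getD]

theorem AddMax.addBox_wordShape {r : ℕ} (h : AddMax T m U r) (hT : IsTab T) (hU : IsTab U)
    (e : KnuthEquiv w (tabWord U)) (e' : KnuthEquiv (w.filter (· < m)) (tabWord T))
    (hw : w.Nodup) :
    AddBox (wordShape (w.filter (· < m))) (r, (wordShape (w.filter (· < m))).rowLen r)
      (wordShape w) :=
  AddBox.of_rowLen fun i => by
    rw [e.rowLen_wordShape hw hU, e'.rowLen_wordShape (hw.filter _) hT, h.length_getD]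

theorem exists_rowInsert_of_append (hw : (w ++ [x]).Nodup) (hT : IsTab T)
    (e : KnuthEquiv w (tabWord T)) : ∃ T' r, RowInsert T x T' r := by
  have hx : x ∉ w := (List.nodup_concat w x).1 (by simpa using hw) |>.1
  exact RowInsert.exists_rowInsert hT (mt e.perm.mem_iff.2 hx)
    (e.perm.nodup_iff.1 hw.of_append_left)

theorem exists_addMax_of_mem (hw : w.Nodup) (hm : m ∈ w) (hmax : ∀ a ∈ w, a ≤ m) (hU : IsTab U)
    (e : KnuthEquiv w (tabWord U)) :
    ∃ T r, IsTab T ∧ AddMax T m U r ∧ KnuthEquiv (w.filter (· < m)) (tabWord T) := by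
  obtain ⟨T, r, hT, hTU, hword⟩ := exists_addMax hU (e.perm.nodup_iff.1 hw) (e.perm.mem_iff.1 hm)
    fun a ha => hmax a (e.perm.mem_iff.2 ha)
  exact ⟨T, r, hT, hTU, hword ▸ e.filter_lt m⟩

theorem exists_addBox_append (hw : (w ++ [x]).Nodup) :
    ∃ c, AddBox (wordShape w) c (wordShape (w ++ [x])) := by
  obtain ⟨T, hT, e⟩ := exists_isTab_knuthEquiv w hw.of_append_left
  obtain ⟨T', r, h⟩ := exists_rowInsert_of_append hw hT e
  exact ⟨_, h.addBox_wordShape hT e hw⟩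

theorem exists_addBox_filter (hw : w.Nodup) (hm : m ∈ w) (hmax : ∀ a ∈ w, a ≤ m) :
    ∃ c, AddBox (wordShape (w.filter (· < m))) c (wordShape w) := by
  obtain ⟨U, hU, e⟩ := exists_isTab_knuthEquiv w hw
  obtain ⟨T, r, hT, h, e'⟩ := exists_addMax_of_mem hw hm hmax hU e
  exact ⟨_, h.addBox_wordShape hT hU e e' hw⟩

theorem fst_eq_zero_of_append_max (hw : (w ++ [x]).Nodup) (hx : ∀ a ∈ w, a < x)
    (h : AddBox (wordShape w) c (wordShape (w ++ [x]))) : c.1 = 0 := by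
  obtain ⟨T, hT, e⟩ := exists_isTab_knuthEquiv w hw.of_append_left
  obtain ⟨T', r, hi⟩ := exists_rowInsert_of_append hw hT e
  rw [h.cell_unique (hi.addBox_wordShape hT e hw)]
  cases hi with
  | nil => rfl
  | last => rfl
  | @bump _ _ l _ y s _ _ hy _ =>
    exact absurd hy (hx y (e.perm.mem_iff.2 (by simp [tabWord]))).asymm

/-- If the maximal letter `m` and the last letter `x` compete for the same cell, then inserting `x`
bumps `m` into the next row. -/
theorem fst_eq_succ_of_append (hw : (w ++ [x]).Nodup) (hm : m ∈ w) (hmax : ∀ a ∈ w ++ [x], a ≤ m)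
    (h : AddBox (wordShape (w.filter (· < m))) c (wordShape w))
    (h' : AddBox (wordShape (w.filter (· < m))) c (wordShape ((w ++ [x]).filter (· < m))))
    (hd : AddBox (wordShape w) d (wordShape (w ++ [x]))) : d.1 = c.1 + 1 := by
  have hx : x ∉ w := (List.nodup_concat w x).1 (by simpa using hw) |>.1
  have hxm : x < m := lt_of_le_of_ne (hmax x (by simp)) (by rintro rfl; exact hx hm)
  have hfilter : (w ++ [x]).filter (· < m) = w.filter (· < m) ++ [x] := by simp [hxm]
  have hwx : (w.filter (· < m) ++ [x]).Nodup := hfilter ▸ hw.filter _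
  rw [hfilter] at h'
  obtain ⟨U, hU, e⟩ := exists_isTab_knuthEquiv w hw.of_append_left
  obtain ⟨T, r, hT, hTU, e'⟩ := exists_addMax_of_mem hw.of_append_left hm
    (fun a ha => hmax a (by simp [ha])) hU e
  obtain ⟨W, s, hTW⟩ := exists_rowInsert_of_append hwx hT e'
  have hcr := h.cell_unique (hTU.addBox_wordShape hT hU e e' hw.of_append_left)
  have hcs := h'.cell_unique (hTW.addBox_wordShape hT e' hwx)
  obtain rfl : r = s := congrArg Prod.fst (hcr.symm.trans hcs)
  have hTm : ∀ a ∈ tabWord T, a < m := fun a ha => by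
    simpa using (List.mem_filter.1 (e'.perm.mem_iff.2 ha)).2
  obtain ⟨W', hUW'⟩ := hTU.rowInsert hTW hTm hxm
  rw [hd.cell_unique (hUW'.addBox_wordShape hU e hw), hcr]

end WordShape

section WordShapeReverse

variable {w : List α} {x m : α} {c d : ℕ × ℕ}

theorem exists_addBox_cons (hw : (x :: w).Nodup) :
    ∃ c, AddBox (wordShape w) c (wordShape (x :: w)) := by
  obtain ⟨c, hc⟩ := exists_addBox_append (List.reverse_cons ▸ List.nodup_reverse.2 hw)
  have hc' := hc.transpose
  rw [← List.reverse_cons, wordShape_reverse hw, wordShape_reverse hw.of_cons,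
    YoungDiagram.transpose_transpose, YoungDiagram.transpose_transpose] at hc'
  exact ⟨_, hc'⟩

theorem snd_eq_zero_of_cons_max (hw : (x :: w).Nodup) (hx : ∀ a ∈ w, a < x)
    (h : AddBox (wordShape w) c (wordShape (x :: w))) : c.2 = 0 := by
  have h' := h.transpose
  rw [← wordShape_reverse hw, ← wordShape_reverse hw.of_cons, List.reverse_cons] at h'
  exact fst_eq_zero_of_append_max (List.reverse_cons ▸ List.nodup_reverse.2 hw)
    (by simpa using hx) h'

theorem snd_eq_succ_of_cons (hw : (x :: w).Nodup) (hm : m ∈ w) (hmax : ∀ a ∈ x :: w, a ≤ m)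
    (h : AddBox (wordShape (w.filter (· < m))) c (wordShape w))
    (h' : AddBox (wordShape (w.filter (· < m))) c (wordShape ((x :: w).filter (· < m))))
    (hd : AddBox (wordShape w) d (wordShape (x :: w))) : d.2 = c.2 + 1 := by
  have h₁ := h.transpose
  have h₂ := h'.transpose
  have h₃ := hd.transpose
  rw [← wordShape_reverse (hw.of_cons.filter _), ← List.filter_reverse] at h₁ h₂
  rw [← wordShape_reverse hw.of_cons] at h₁ h₃
  rw [← wordShape_reverse (hw.filter _), ← List.filter_reverse, List.reverse_cons] at h₂
  rw [← wordShape_reverse hw, List.reverse_cons] at h₃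
  exact fst_eq_succ_of_append (List.reverse_cons ▸ List.nodup_reverse.2 hw) (by simpa using hm)
    (fun a ha => hmax a (by simpa [or_comm] using ha)) h₁ h₂ h₃

end WordShapeReverse

theorem AddBox.aligned_of_cube {μ μ₁ μ₂ μ₃ ν ν₁ ν₂ : YoungDiagram}
    {a b a' b' m m₁ m₂ m₃ c c' : ℕ × ℕ} (ha : AddBox μ a μ₁) (hb : AddBox μ b μ₂)
    (ha' : AddBox μ₂ a' μ₃) (hb' : AddBox μ₁ b' μ₃) (hm : AddBox μ m ν) (hm₁ : AddBox μ₁ m₁ ν₁)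
    (hm₂ : AddBox μ₂ m₂ ν₁) (hm₃ : AddBox μ₃ m₃ ν₂) (hc : AddBox ν c ν₁) (hc' : AddBox ν₁ c' ν₂)
    (col : m = a → c.2 = m.2 + 1) (row : m = b → c.1 = m.1 + 1)
    (col' : m₂ = a' → c'.2 = m₂.2 + 1) (row' : m₁ = b' → c'.1 = m₁.1 + 1)
    (aligned : a = b → b'.1 = a.1 ∨ b'.2 = a.2) : c'.1 = c.1 ∨ c'.2 = c.2 := by
  have left := ha.eq_or_eq_of_mem hm₁ hm hc
  rcases eq_or_ne a b with rfl | hab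
  · obtain rfl := ha.right_unique hb
    obtain rfl := ha'.cell_unique hb'
    obtain rfl := hm₁.cell_unique hm₂
    rcases left with ⟨rfl, -⟩ | ⟨rfl, rfl⟩
    · exact absurd ⟨row rfl, col rfl⟩ (hm.not_diagonal hc)
    · rcases hb'.eq_or_eq_of_mem hm₃ hm₁ hc' with ⟨rfl, -⟩ | ⟨rfl, -⟩
      · exact absurd ⟨row' rfl, col' rfl⟩ (hm₁.not_diagonal hc')
      · exact aligned rfl
  · obtain ⟨rfl, rfl⟩ := (ha.eq_or_eq_of_mem hm₁ hb hm₂).resolve_left fun h => hab h.1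
    obtain ⟨rfl, rfl⟩ := (ha.eq_or_eq_of_mem hb' hb ha').resolve_left fun h => hab h.1
    rcases left with ⟨rfl, rfl⟩ | ⟨rfl, rfl⟩
    · exact Or.inr ((col' rfl).trans (col rfl).symm)
    · exact Or.inl ((row' rfl).trans (row rfl).symm)

/-- If the letters `p` and `q` add the same cell when put in front of or behind `w`, then the
further cell added by putting both lies in the same row or in the same column. -/
def Aligned (p : α) (w : List α) (q : α) : Prop :=
  ∀ ⦃c c' : ℕ × ℕ⦄, AddBox (wordShape w) c (wordShape (p :: w)) →
    AddBox (wordShape w) c (wordShape (w ++ [q])) →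
    AddBox (wordShape (p :: w)) c' (wordShape (p :: w ++ [q])) → c'.1 = c.1 ∨ c'.2 = c.2

namespace Aligned

variable {p q m : α} {w : List α}

theorem of_forall_lt_left (hw : (p :: w ++ [q]).Nodup) (hp : ∀ a ∈ w ++ [q], a < p) :
    Aligned p w q := fun c c' hpc hqc hc' => by
  rw [hpc.right_unique hqc] at hc'
  right
  rw [snd_eq_zero_of_cons_max hw.of_append_left (fun a ha => hp a (by simp [ha])) hpc]
  exact snd_eq_zero_of_cons_max hw hp hc'

theorem of_forall_lt_right (hw : (p :: w ++ [q]).Nodup) (hq : ∀ a ∈ p :: w, a < q) :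
    Aligned p w q := fun c c' _ hqc hc' => by
  left
  rw [fst_eq_zero_of_append_max hw.of_cons (fun a ha => hq a (by simp [ha])) hqc]
  exact fst_eq_zero_of_append_max hw hq hc'

theorem of_filter (hw : (p :: w ++ [q]).Nodup) (hm : m ∈ w) (hmax : ∀ a ∈ p :: w ++ [q], a ≤ m)
    (hp : p < m) (hq : q < m) (h : Aligned p (w.filter (· < m)) q) : Aligned p w q := by
  intro c c' hpc hqc hc'
  have hpw := hw.of_append_left
  have hwq : (w ++ [q]).Nodup := hw.of_cons
  have maxl : ∀ a ∈ p :: w, a ≤ m := fun a ha => hmax a (List.mem_append_left _ ha)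
  have maxr : ∀ a ∈ w ++ [q], a ≤ m := fun a ha => hmax a (List.mem_cons_of_mem _ ha)
  have filter_left : ∀ u, (p :: u).filter (· < m) = p :: u.filter (· < m) := by simp [hp]
  have filter_right : ∀ u, (u ++ [q]).filter (· < m) = u.filter (· < m) ++ [q] := by simp [hq]
  have filter_both : (p :: w ++ [q]).filter (· < m) = p :: w.filter (· < m) ++ [q] := by
    rw [filter_right, filter_left]
  have hv : (p :: w.filter (· < m) ++ [q]).Nodup := filter_both ▸ hw.filter _
  obtain ⟨a, ha⟩ := exists_addBox_cons hv.of_append_left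
  obtain ⟨b, hb⟩ := exists_addBox_append (w := w.filter (· < m)) hv.of_cons
  obtain ⟨a', ha'⟩ := exists_addBox_cons (w := w.filter (· < m) ++ [q]) hv
  obtain ⟨b', hb'⟩ := exists_addBox_append hv
  obtain ⟨e, he⟩ := exists_addBox_filter hpw.of_cons hm fun a ha => maxl a (by simp [ha])
  obtain ⟨e₁, he₁⟩ := exists_addBox_filter hpw (List.mem_cons_of_mem _ hm) maxl
  obtain ⟨e₂, he₂⟩ := exists_addBox_filter hwq (List.mem_append_left _ hm) maxr
  obtain ⟨e₃, he₃⟩ := exists_addBox_filter hw (by simp [hm]) hmax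
  have shape_eq := hpc.right_unique hqc
  have hc'' : AddBox (wordShape (w ++ [q])) c' (wordShape (p :: (w ++ [q]))) := shape_eq ▸ hc'
  have key := h (c := a) (c' := b') ha
  rw [← filter_both, ← filter_left] at hb' key
  rw [← filter_right] at hb key
  rw [← filter_left] at ha
  rw [← filter_right, ← filter_left] at ha'
  exact AddBox.aligned_of_cube ha hb ha' hb' he he₁ (shape_eq ▸ he₂) he₃ hpc hc'
    (fun h => snd_eq_succ_of_cons hpw hm maxl he (h ▸ ha) hpc)
    (fun h => fst_eq_succ_of_append hwq hm maxr he (h ▸ hb) hqc)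
    (fun h => snd_eq_succ_of_cons hw (by simp [hm]) hmax he₂ (h ▸ ha') hc'')
    (fun h => fst_eq_succ_of_append hw (by simp [hm]) hmax he₁ (h ▸ hb') hc')
    fun h => key (h ▸ hb) hb'

end Aligned

theorem aligned {p q : α} {w : List α} (hw : (p :: w ++ [q]).Nodup) : Aligned p w q := by
  induction hl : w.length using Nat.strong_induction_on generalizing w with
  | _ l ih =>
  obtain ⟨m, hm, hmax⟩ := Finset.exists_max_image (p :: w ++ [q]).toFinset id ⟨p, by simp⟩
  simp only [List.mem_toFinset, id] at hm hmax
  have lt_max : ∀ a ∈ p :: w ++ [q], a ≠ m → a < m := fun a ha => (hmax a ha).lt_of_ne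
  have hp : p ∉ w ++ [q] := (List.nodup_cons.1 hw).1
  have hq : q ∉ p :: w := (List.nodup_concat _ q).1 (by simpa using hw) |>.1
  rw [List.cons_append, List.mem_cons, List.mem_append, List.mem_singleton] at hm
  rcases hm with rfl | hm | rfl
  · exact .of_forall_lt_left hw fun a ha =>
      lt_max a (List.mem_cons_of_mem _ ha) (ne_of_mem_of_not_mem ha hp)
  · have hpm : p < m := lt_max p (by simp) (by rintro rfl; simp [hm] at hp)
    have hqm : q < m := lt_max q (by simp) (by rintro rfl; simp [hm] at hq)
    refine .of_filter hw hm hmax hpm hqm (ih _ ?_ ?_ rfl)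
    · exact hl ▸ List.length_filter_lt_length_iff_exists.2 ⟨m, hm, by simp⟩
    · simpa [hpm, hqm] using hw.filter (· < m)
  · exact .of_forall_lt_right hw fun a ha =>
      lt_max a (List.mem_append_left _ ha) (ne_of_mem_of_not_mem ha hq)

theorem wordShape_append_eq_localRule {p q : α} {w : List α} (hw : (p :: w ++ [q]).Nodup) :
    wordShape (w ++ [q]) =
      localRule (wordShape (p :: w)) (wordShape w) (wordShape (p :: w ++ [q])) := by
  obtain ⟨a, ha⟩ := exists_addBox_cons hw.of_append_left
  obtain ⟨b, hb⟩ := exists_addBox_append (hw.of_cons : (w ++ [q]).Nodup)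
  obtain ⟨a', ha'⟩ := exists_addBox_append hw
  obtain ⟨b', hb'⟩ := exists_addBox_cons (show (p :: (w ++ [q])).Nodup from hw)
  by_cases hab : a = b
  · subst hab
    have unique : ∀ ν, wordShape w < ν → ν < wordShape (p :: w ++ [q]) → ν = wordShape (p :: w) :=
      fun ν hν hν' => by_contra fun hne => hne <| ha.eq_of_aligned ha' (aligned hw ha hb ha')
        (covBy_of_between ha.covBy ha'.covBy hν hν' hne).1 hν'.le
    rw [localRule_eq_left unique]
    exact hb.right_unique ha
  · have hne : wordShape (w ++ [q]) ≠ wordShape (p :: w) := fun h => hab (ha.cell_unique (h ▸ hb))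
    exact (localRule_eq_of_between ha.covBy ha'.covBy hb.lt hb'.lt hne).symm

end Words

section Chains

variable {γ : Type*} [PartialOrder γ] {S : Finset γ} {k m : ℕ} {g : γ → ℕ}

/-- A colouring of the poset `S` whose colours below `k` form chains. -/
def IsChainColoring (S : Finset γ) (k : ℕ) (g : γ → ℕ) : Prop :=
  ∀ t < k, IsChain (· ≤ ·) {x | x ∈ S ∧ g x = t}

variable [DecidableEq γ]

theorem IsChainColoring.card_le_maxChainUnion (hg : IsChainColoring S k g) :
    (S.filter (g · < k)).card ≤ maxChainUnion S k := by
  refine le_csSup ⟨S.card, ?_⟩ ⟨fun t => S.filter (g · = t), fun t => ⟨S.filter_subset _, ?_⟩, ?_⟩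
  · rintro _ ⟨C, hC, rfl⟩
    exact Finset.card_le_card (Finset.biUnion_subset.2 fun t _ => (hC t).1)
  · simpa only [Finset.coe_filter] using hg t t.2
  · congr 1
    ext x
    simp [Fin.exists_iff]

theorem exists_isChainColoring {C : Fin k → Finset γ}
    (hC : ∀ t, C t ⊆ S ∧ IsChain (· ≤ ·) (C t : Set γ)) :
    ∃ g, IsChainColoring S k g ∧ Finset.univ.biUnion C ⊆ S.filter (g · < k) := by
  classical
  have color : ∀ x, ∃ c : ℕ, (∀ t : Fin k, c = t → x ∈ C t) ∧ ((∃ t, x ∈ C t) → c < k) := by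
    intro x
    by_cases h : ∃ t, x ∈ C t
    · obtain ⟨t, ht⟩ := h
      exact ⟨t, fun s hs => Fin.ext hs ▸ ht, fun _ => t.2⟩
    · exact ⟨k, fun t ht => absurd ht.symm t.2.ne, fun h' => absurd h' h⟩
  choose g hmem hlt using color
  refine ⟨g, fun t ht => (hC ⟨t, ht⟩).2.mono fun x hx => hmem x ⟨t, ht⟩ hx.2, fun x hx => ?_⟩
  obtain ⟨t, -, ht⟩ := Finset.mem_biUnion.1 hx
  exact Finset.mem_filter.2 ⟨(hC t).1 ht, hlt x ⟨t, ht⟩⟩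

theorem maxChainUnion_le_iff :
    maxChainUnion S k ≤ m ↔ ∀ g, IsChainColoring S k g → (S.filter (g · < k)).card ≤ m := by
  refine ⟨fun h g hg => hg.card_le_maxChainUnion.trans h, fun h => ?_⟩
  refine csSup_le ⟨_, fun _ => ∅, by simp, rfl⟩ ?_
  rintro _ ⟨C, hC, rfl⟩
  obtain ⟨g, hg, hsub⟩ := exists_isChainColoring hC
  exact (Finset.card_le_card hsub).trans (h g hg)

theorem shape_eq_of_rowLen {μ : YoungDiagram} (h : ∀ r, chainRow S r = μ.rowLen r)
    (hc : μ.card = S.card) : shape S = μ := by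
  ext ⟨a, b⟩
  simp only [shape, Finset.mem_filter, Finset.mem_product, Finset.mem_range, h,
    YoungDiagram.mem_cells]
  refine ⟨fun hb => YoungDiagram.mem_iff_lt_rowLen.2 (hb.2 a le_rfl), fun hab => ?_⟩
  have hb := YoungDiagram.mem_iff_lt_rowLen.1 hab
  have ha := YoungDiagram.mem_iff_lt_colLen.1 hab
  have hrow : μ.rowLen a ≤ μ.card := by
    rw [YoungDiagram.rowLen_eq_card]
    exact Finset.card_le_card (Finset.filter_subset _ _)
  have hcol : μ.colLen b ≤ μ.card := by
    rw [YoungDiagram.colLen_eq_card]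
    exact Finset.card_le_card (Finset.filter_subset _ _)
  exact ⟨⟨by omega, by omega⟩, fun r hr => hb.trans_le (μ.rowLen_anti r a hr)⟩

end Chains

section Graph

variable {α β : Type*} [LinearOrder α] [LinearOrder β] {f : α → β} {l : List α} {k : ℕ}

/-- The points of the graph of `f` over the entries of `l`, as a subposet of the product order. -/
def graphPoset (f : α → β) (l : List α) : Finset (α × β) :=
  l.toFinset.image fun a => (a, f a)

theorem isChainColoring_graphPoset_iff (hf : f.Injective) (hl : l.Pairwise (· < ·))
    {g : α × β → ℕ} {g' : β → ℕ} (hg : ∀ a, g' (f a) = g (a, f a)) :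
    IsChainColoring (graphPoset f l) k g ↔ IsIncreasingColoring k (l.map f) g' := by
  rw [IsIncreasingColoring, List.pairwise_map]
  have mem : ∀ {a}, a ∈ l → (a, f a) ∈ graphPoset f l := fun ha =>
    Finset.mem_image_of_mem _ (List.mem_toFinset.2 ha)
  constructor
  · intro h
    refine hl.imp_of_mem fun {a b} ha hb hab heq hk => ?_
    rw [hg, hg] at heq
    rw [hg] at hk
    rcases (h _ hk).total ⟨mem ha, rfl⟩ ⟨mem hb, heq.symm⟩ with hle | hle
    · exact hle.2.lt_of_ne (hf.ne hab.ne)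
    · exact absurd hle.1 hab.not_ge
  · intro h t ht
    have comparable := (hl.and h).imp (S := fun a b => g' (f a) = t → g' (f b) = t →
        (a, f a) ≤ (b, f b) ∨ (b, f b) ≤ (a, f a)) fun hab ha hb =>
      Or.inl ⟨hab.1.le, (hab.2 (ha.trans hb.symm) (ha ▸ ht)).le⟩
    have : Std.Symm fun a b => g' (f a) = t → g' (f b) = t →
        (a, f a) ≤ (b, f b) ∨ (b, f b) ≤ (a, f a) := ⟨fun a b hab hb ha => (hab ha hb).symm⟩
    rintro p ⟨hp, hpt⟩ q ⟨hq, hqt⟩ hne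
    obtain ⟨a, ha, rfl⟩ := Finset.mem_image.1 hp
    obtain ⟨b, hb, rfl⟩ := Finset.mem_image.1 hq
    exact comparable.forall (List.mem_toFinset.1 ha) (List.mem_toFinset.1 hb)
      (fun hab => hne (by rw [hab])) ((hg a).trans hpt) ((hg b).trans hqt)

theorem card_filter_graphPoset (hl : l.Nodup) {g : α × β → ℕ} {g' : β → ℕ}
    (hg : ∀ a, g' (f a) = g (a, f a)) :
    ((graphPoset f l).filter (g · < k)).card = (l.map f).countP (g' · < k) := by
  have hinj : Function.Injective fun a => (a, f a) := fun a b h => (Prod.mk.inj h).1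
  rw [graphPoset, Finset.filter_image, Finset.card_image_of_injective _ hinj, List.countP_map,
    ← countP_eq_card_filter hl]
  simp only [Function.comp_def, hg]

theorem maxChainUnion_graphPoset (hf : f.Injective) (hl : l.Pairwise (· < ·)) (k : ℕ) :
    maxChainUnion (graphPoset f l) k = greeneNumber k (l.map f) := by
  refine eq_of_forall_ge_iff fun m => ?_
  rw [maxChainUnion_le_iff, greeneNumber_le_iff]
  have hnd : l.Nodup := hl.imp ne_of_lt
  constructor
  · intro h g hg
    rw [← card_filter_graphPoset (g := g ∘ Prod.snd) hnd fun _ => rfl]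
    exact h _ ((isChainColoring_graphPoset_iff hf hl fun _ => rfl).2 hg)
  · intro h g hg
    have hext := hf.extend_apply (fun a => g (a, f a)) 0
    rw [card_filter_graphPoset hnd hext]
    exact h _ ((isChainColoring_graphPoset_iff hf hl hext).1 hg)

theorem chainRow_graphPoset (hf : f.Injective) (hl : l.Pairwise (· < ·)) (r : ℕ) :
    chainRow (graphPoset f l) r = (wordShape (l.map f)).rowLen r := by
  have hw : (l.map f).Nodup := List.Nodup.map hf (hl.imp ne_of_lt)
  rw [chainRow, maxChainUnion_graphPoset hf hl, maxChainUnion_graphPoset hf hl,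
    (hasShape_wordShape hw).greeneNumber_eq, (hasShape_wordShape hw).greeneNumber_eq,
    Finset.sum_range_succ, Nat.add_sub_cancel_left]

theorem card_wordShape {w : List α} (hw : w.Nodup) : (wordShape w).card = w.length := by
  induction w with
  | nil => simp [wordShape_nil, YoungDiagram.card]
  | cons x w ih =>
    obtain ⟨c, h⟩ := exists_addBox_cons hw
    rw [h.card, ih hw.of_cons, List.length_cons]

theorem shape_graphPoset (hf : f.Injective) (hl : l.Pairwise (· < ·)) :
    shape (graphPoset f l) = wordShape (l.map f) := by
  have hnd : l.Nodup := hl.imp ne_of_lt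
  refine shape_eq_of_rowLen (chainRow_graphPoset hf hl) ?_
  rw [card_wordShape (hnd.map hf), List.length_map, graphPoset,
    Finset.card_image_of_injective _ fun a b h => (Prod.mk.inj h).1,
    List.toFinset_card_of_nodup hnd]

end Graph

section Interval

variable {n : ℕ}

/-- The positions `i, …, j`, counted from `1`, in increasing order. -/
def intervalList (n i j : ℕ) : List (Fin n) :=
  (List.finRange n).filter fun k => i ≤ (k : ℕ) + 1 ∧ (k : ℕ) + 1 ≤ j

theorem mem_intervalList {i j : ℕ} {k : Fin n} :
    k ∈ intervalList n i j ↔ i ≤ (k : ℕ) + 1 ∧ (k : ℕ) + 1 ≤ j := by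
  simp [intervalList]

theorem pairwise_intervalList (n i j : ℕ) : (intervalList n i j).Pairwise (· < ·) :=
  List.Pairwise.filter _ (List.pairwise_lt_finRange n)

theorem intervalList_eq_nil {i j : ℕ} (h : j < i) : intervalList n i j = [] := by
  refine List.eq_nil_iff_forall_not_mem.2 fun k hk => ?_
  rw [mem_intervalList] at hk
  omega

theorem intervalList_append {i j : ℕ} (hij : i ≤ j + 1) (hj : j < n) :
    intervalList n i (j + 1) = intervalList n i j ++ [⟨j, hj⟩] := by
  apply List.Pairwise.eq_of_mem_iff (pairwise_intervalList _ _ _)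
  · refine List.pairwise_append.2 ⟨pairwise_intervalList _ _ _, List.pairwise_singleton _ _, ?_⟩
    intro a ha b hb
    rw [List.mem_singleton.1 hb, Fin.lt_def]
    exact (mem_intervalList.1 ha).2
  · intro k
    simp only [List.mem_append, mem_intervalList, List.mem_singleton, Fin.ext_iff]
    omega

theorem intervalList_cons {i j : ℕ} (hi : i < n) (hij : i < j) :
    intervalList n (i + 1) j = ⟨i, hi⟩ :: intervalList n (i + 2) j := by
  apply List.Pairwise.eq_of_mem_iff (pairwise_intervalList _ _ _)
  · refine List.pairwise_cons.2 ⟨fun a ha => ?_, pairwise_intervalList _ _ _⟩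
    rw [Fin.lt_def]
    exact Nat.le_of_succ_le_succ (mem_intervalList.1 ha).1
  · intro k
    simp only [List.mem_cons, mem_intervalList, Fin.ext_iff]
    omega

theorem intervalList_one_eq_reverse_map_rev {k : ℕ} (hk : k ≤ n) :
    intervalList n 1 k = (intervalList n (n + 1 - k) n).reverse.map Fin.rev := by
  apply List.Pairwise.eq_of_mem_iff (pairwise_intervalList _ _ _)
  · rw [List.pairwise_map, List.pairwise_reverse]
    exact (pairwise_intervalList _ _ _).imp Fin.rev_lt_rev.2
  · intro a
    rw [← Fin.rev_rev a, List.mem_map_of_injective Fin.rev_injective, List.mem_reverse]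
    simp only [mem_intervalList, Fin.val_rev]
    omega

variable (σ : Equiv.Perm (Fin n))

theorem nodup_map_intervalList (i j : ℕ) : ((intervalList n i j).map σ).Nodup :=
  List.Nodup.map σ.injective ((pairwise_intervalList n i j).imp ne_of_lt)

theorem permInterval_eq_graphPoset (i j : ℕ) :
    permInterval σ i j = graphPoset σ (intervalList n i j) := by
  unfold permInterval graphPoset
  congr 1
  ext k
  simp [mem_intervalList]

theorem intervalShape_eq_wordShape (i j : ℕ) :
    intervalShape σ i j = wordShape ((intervalList n i j).map σ) := by
  rw [intervalShape, permInterval_eq_graphPoset,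
    shape_graphPoset σ.injective (pairwise_intervalList n i j)]

theorem rowLen_intervalShape (i j r : ℕ) :
    (intervalShape σ i j).rowLen r = chainRow (permInterval σ i j) r := by
  rw [intervalShape_eq_wordShape, permInterval_eq_graphPoset,
    chainRow_graphPoset σ.injective (pairwise_intervalList n i j)]

theorem intervalShape_eq_bot {i j : ℕ} (h : j < i) : intervalShape σ i j = ⊥ := by
  rw [intervalShape_eq_wordShape, intervalList_eq_nil h, List.map_nil, wordShape_nil]

theorem intervalShape_covBy {i j : ℕ} (hij : i ≤ j + 1) (hj : j < n) :
    intervalShape σ i j ⋖ intervalShape σ i (j + 1) := by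
  have hw := nodup_map_intervalList σ i (j + 1)
  simp only [intervalShape_eq_wordShape, intervalList_append hij hj, List.map_append,
    List.map_singleton] at hw ⊢
  obtain ⟨c, h⟩ := exists_addBox_append hw
  exact h.covBy

theorem intervalShape_eq_localRule {i j : ℕ} (hij : i < j) (hj : j < n) :
    intervalShape σ (i + 2) (j + 1) = localRule (intervalShape σ (i + 1) j)
      (intervalShape σ (i + 2) j) (intervalShape σ (i + 1) (j + 1)) := by
  have hw := nodup_map_intervalList σ (i + 1) (j + 1)
  simp only [intervalShape_eq_wordShape, intervalList_append (i := i + 1) (by omega) hj,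
    intervalList_append (i := i + 2) (by omega) hj, intervalList_cons (hij.trans hj) hij,
    List.map_append, List.map_cons, List.map_nil] at hw ⊢
  exact wordShape_append_eq_localRule hw

theorem isGrowth_intervalShape : IsGrowth n (intervalShape σ 1) :=
  ⟨intervalShape_eq_bot σ Nat.zero_lt_one, fun _ => intervalShape_covBy σ (by omega)⟩

theorem isLocalGrowth_intervalShape : IsLocalGrowth n fun i j => intervalShape σ (i + 1) j where
  diag i _ := intervalShape_eq_bot σ i.lt_succ_self
  row _ := (isGrowth_intervalShape σ).2 _
  rule := intervalShape_eq_localRule σ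

theorem intervalShape_rotate {k : ℕ} (hk : k ≤ n) :
    intervalShape (rotate σ) 1 k = intervalShape σ (n + 1 - k) n := by
  have hmap : (intervalList n 1 k).map (rotate σ) =
      ((intervalList n (n + 1 - k) n).map σ).reverse.map Fin.rev := by
    rw [intervalList_one_eq_reverse_map_rev hk, ← List.map_reverse, List.map_map, List.map_map]
    exact List.map_congr_left fun a _ => by simp [rotate]
  rw [intervalShape_eq_wordShape, intervalShape_eq_wordShape, hmap,
    wordShape_reverse_map Fin.rev_strictAnti (nodup_map_intervalList σ _ _)]

theorem intervalShape_local_rule {i j : ℕ} (hi : 1 < i) (hij : i ≤ j) (hj : j < n) :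
    (∀ ν : YoungDiagram, ν ≠ intervalShape σ (i - 1) j → intervalShape σ i j < ν →
      ν < intervalShape σ (i - 1) (j + 1) → intervalShape σ i (j + 1) = ν) ∧
    ((¬ ∃ ν : YoungDiagram, ν ≠ intervalShape σ (i - 1) j ∧ intervalShape σ i j < ν ∧
      ν < intervalShape σ (i - 1) (j + 1)) →
        intervalShape σ i (j + 1) = intervalShape σ (i - 1) j) := by
  obtain ⟨i, rfl⟩ := Nat.exists_eq_add_of_le' hi
  have h := isLocalGrowth_intervalShape σ
  have hrule := intervalShape_eq_localRule σ (i := i) (j := j) (by omega) hj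
  refine ⟨fun ν hne hbν hνt => hrule.trans ?_, fun hno => hrule.trans ?_⟩
  · exact localRule_eq_of_between (h.covBy_col (by omega) hj.le) (h.covBy_row (by omega) hj)
      hbν hνt hne
  · exact localRule_eq_left fun ν hbν hνt => by_contra fun hne => hno ⟨ν, hne, hbν, hνt⟩

end Interval

section Evacuation

variable {n : ℕ}

/-- The tableau `Q(σ)`: it records where the shapes `λ_[1;1], λ_[1;2], …` gain their boxes. -/
noncomputable def recordingTableau (σ : Equiv.Perm (Fin n)) : StandardTableau n :=
  (isGrowth_intervalShape σ).tableau

theorem encodes_recordingTableau (σ : Equiv.Perm (Fin n)) :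
    (recordingTableau σ).Encodes (intervalShape σ 1) :=
  (isGrowth_intervalShape σ).encodes_tableau

theorem encodes_recordingTableau_rotate (σ : Equiv.Perm (Fin n)) :
    (recordingTableau (rotate σ)).Encodes fun k => intervalShape σ (n + 1 - k) n :=
  fun k hk => (encodes_recordingTableau _ k hk).trans (intervalShape_rotate σ hk)

theorem growthArray_recordingTableau (σ : Equiv.Perm (Fin n)) {i j : ℕ} (hi : 1 ≤ i)
    (hij : i ≤ j + 1) (hj : j ≤ n) :
    growthArray (recordingTableau σ).sub i j = intervalShape σ i j := by
  obtain ⟨i, rfl⟩ := Nat.exists_eq_add_of_le' hi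
  exact (isLocalGrowth_growthArray (recordingTableau σ).isGrowth_sub).ext
    (isLocalGrowth_intervalShape σ) (encodes_recordingTableau σ) (Nat.le_of_succ_le_succ hij) hj

/-- The Schützenberger involution `ev(T)`, read off the last column of the array grown from `T`. -/
noncomputable def evacuation (T : StandardTableau n) : StandardTableau n :=
  (isLocalGrowth_growthArray T.isGrowth_sub).reflect.isGrowth_row.tableau

theorem sub_evacuation (T : StandardTableau n) {k : ℕ} (hk : k ≤ n) :
    (evacuation T).sub k = growthArray T.sub (n - k + 1) n :=
  (isLocalGrowth_growthArray T.isGrowth_sub).reflect.isGrowth_row.encodes_tableau k hk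

theorem encodes_evacuation (T : StandardTableau n) :
    (evacuation T).Encodes fun k => growthArray T.sub (n + 1 - k) n := fun k hk => by
  simp only [sub_evacuation T hk, Nat.sub_add_comm hk]

theorem evacuation_recordingTableau (σ : Equiv.Perm (Fin n)) :
    evacuation (recordingTableau σ) = recordingTableau (rotate σ) :=
  (encodes_evacuation _).unique fun k hk => by
    rw [encodes_recordingTableau_rotate σ k hk]
    exact (growthArray_recordingTableau σ (by omega) (by omega) le_rfl).symm

theorem diagram_evacuation (T : StandardTableau n) : (evacuation T).diagram = T.diagram := by
  rw [← StandardTableau.sub_self, sub_evacuation T le_rfl, Nat.sub_self, ← T.sub_self]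
  rfl

theorem growthArray_evacuation (T : StandardTableau n) {i j : ℕ} (hij : i ≤ j) (hj : j ≤ n) :
    growthArray (evacuation T).sub (i + 1) j = growthArray T.sub (n - j + 1) (n - i) :=
  (isLocalGrowth_growthArray (evacuation T).isGrowth_sub).ext
    (isLocalGrowth_growthArray T.isGrowth_sub).reflect (fun _ => sub_evacuation T) hij hj

theorem evacuation_involutive : Function.Involutive (evacuation (n := n)) := fun T =>
  StandardTableau.Encodes.unique (μ := T.sub) (fun k hk => by
    rw [sub_evacuation _ hk, growthArray_evacuation T (Nat.sub_le n k) le_rfl, Nat.sub_self,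
      Nat.sub_sub_self hk]
    rfl) fun _ _ => rfl

end Evacuation

end PosetGrowth

theorem theorem4p1 (n : ℕ) :
    -- the shapes are well defined: the rows of the Young diagram have the prescribed lengths
    (∀ (σ : Equiv.Perm (Fin n)) (i j r : ℕ),
      (PosetGrowth.intervalShape σ i j).rowLen r =
        PosetGrowth.chainRow (PosetGrowth.permInterval σ i j) r) ∧
    -- the local growth rule
    (∀ (σ : Equiv.Perm (Fin n)) (i j : ℕ), 1 < i → i ≤ j → j < n →
      (∀ ν : YoungDiagram, ν ≠ PosetGrowth.intervalShape σ (i - 1) j →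
        PosetGrowth.intervalShape σ i j < ν →
        ν < PosetGrowth.intervalShape σ (i - 1) (j + 1) →
          PosetGrowth.intervalShape σ i (j + 1) = ν) ∧
      ((¬ ∃ ν : YoungDiagram, ν ≠ PosetGrowth.intervalShape σ (i - 1) j ∧
        PosetGrowth.intervalShape σ i j < ν ∧
        ν < PosetGrowth.intervalShape σ (i - 1) (j + 1)) →
          PosetGrowth.intervalShape σ i (j + 1) = PosetGrowth.intervalShape σ (i - 1) j)) ∧
    -- the tableaux `Q(σ)`, `Q'(σ)` and the involution computed by the growth rule
    (∃ (Q Q' : Equiv.Perm (Fin n) → PosetGrowth.StandardTableau n)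
        (ev : PosetGrowth.StandardTableau n → PosetGrowth.StandardTableau n),
      (∀ σ, (Q σ).Encodes fun k => PosetGrowth.intervalShape σ 1 k) ∧
      (∀ σ, (Q' σ).Encodes fun k => PosetGrowth.intervalShape σ (n + 1 - k) n) ∧
      (∀ T, (ev T).Encodes fun k => PosetGrowth.growthArray T.sub (n + 1 - k) n) ∧
      (∀ σ, Q' σ = Q (PosetGrowth.rotate σ)) ∧
      (∀ σ i j, 1 ≤ i → i ≤ j → j ≤ n →
        PosetGrowth.growthArray (Q σ).sub i j = PosetGrowth.intervalShape σ i j) ∧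
      (∀ σ, ev (Q σ) = Q' σ) ∧
      (∀ T, (ev T).diagram = T.diagram) ∧
      Function.Involutive ev) :=
  ⟨PosetGrowth.rowLen_intervalShape,
    fun σ _ _ => PosetGrowth.intervalShape_local_rule σ,
    PosetGrowth.recordingTableau,
    fun σ => PosetGrowth.recordingTableau (PosetGrowth.rotate σ),
    PosetGrowth.evacuation,
    PosetGrowth.encodes_recordingTableau,
    PosetGrowth.encodes_recordingTableau_rotate,
    PosetGrowth.encodes_evacuation,
    fun _ => rfl,
    fun σ _ _ hi hij => PosetGrowth.growthArray_recordingTableau σ hi (Nat.le_succ_of_le hij),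
    PosetGrowth.evacuation_recordingTableau,
    PosetGrowth.diagram_evacuation,
    PosetGrowth.evacuation_involutive⟩
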